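/- Let $F=\mathbb F_8$, let $z\in F$ with $z^3=z+1$ (so $F^\times=\langle z\rangle$), let $G=\mathrm{SL}(2,F)$, let $\varphi$ denote the Frobenius map $x\mapsto x^2$ applied entrywise to matrices, and write $(a,b;c,d)$ for the matrix $\begin{pmatrix}a&b\\c&d\end{pmatrix}$. Let $g=(z^2,z^4;z^4,z)$, $f=(0,1;1,0)$, $C=\langle g\rangle\le G$, and $D^h=h^{-1}Dh$ for $D\subseteq G$, $h\in G$. **Unitals.** A unital of order $n$ is a $2$-$(n^3+1,n+1,1)$ design. An affine unital of order $n\ge 2$ is an incidence structure with $n^3-n$ points in which every block has $n$ points (short block) or $n+1$ points (long block), every point is on $n^2$ blocks, any two points are on exactly one common block, and there is a parallelism, i.e. a partition of the set of short blocks into $n+1$ classes of $n^2-1$ pairwise disjoint blocks. If $\mathbb U$ is an affine unital with parallelism $\pi$, its closure $\mathbb U^\pi$ is obtained by adding, for each class of $\pi$, one new point incident with exactly the short blocks of this class, and one new block $[\infty]$ whose points are the new points. Isomorphisms and automorphisms are bijections of the point sets that map the block set onto the block set. **Affine $\mathrm{SL}(2,8)$-unitals.** Let $S\le G$ be a subgroup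 of order $9$ and $\mathcal D$ a set of $9$-element subsets of $G$ containing $1$ such that (Q) for each $D\in\mathcal D$ the map $(x,y)\mapsto xy^{-1}$ is injective on $\{(x,y)\in D\times D: x\ne y\}$, with image denoted $D^*$, and (P) the sets $S\smallsetminus\{1\}$, $T\smallsetminus\{1\}$ ($T$ a Sylow $2$-subgroup of $G$) and $D^*$ ($D\in\mathcal D$) partition $G\smallsetminus\{1\}$. Then the incidence structure $\mathbb U_{S,\mathcal D}$ with point set $G$ whose blocks are all sets $Sh$, $Th$ ($T$ a Sylow $2$-subgroup) and $Dh$ ($D\in\mathcal D$), $h\in G$, is called an affine $\mathrm{SL}(2,8)$-unital. The flat and the natural parallelism are $$\flat=\{\{Th\mid h\in G\}\mid T\in\mathrm{Syl}_2(G)\},\qquad \natural=\{\{hT\mid h\in G\}\mid T\in\mathrm{Syl}_2(G)\}.$$ **The three examples.** * $\mathbb{WU}=\mathbb U_{C,\mathcal D}$ with $\mathcal D=\{A_1,\varphi(A_1),\varphi^2(A_1),A_4,\varphi(A_4),\varphi^2(A_4)\}$, where $A_1=\{1,(z^5,1;z^5,z^6),(z^4,z^2;1,z^2),(0,z;z^6,z^2),(1,z^4;z^2,z^2),(1,z;z^6,0),(1,z^2;1,z^6),(z^4,1;z^5,1),(z^5,0;0,z^2)\}$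 and $A_4=\{1,(z^5,0;z^6,z^2),(z,z^6;z^4,1),(0,z;z^6,z^5),(z^4,0;z^2,z^3),(z^5,z^2;z^3,z^6),(0,z^2;z^5,z^5),(0,z^4;z^3,z^4),(z^2,z^5;z^5,z^6)\}$. * $\mathbb{OU}=\mathbb U_{C,\mathcal D}$ with $\mathcal D=\{B_1,B_1^g,B_1^{g^2},B_4,B_4^g,B_4^{g^2}\}$, where $B_1=\{1,(z^5,1;z^5,z^6),(z^4,z^2;1,z^2),(1,z;z^6,0),(0,z;z^6,z^2),(1,z^4;z^2,z^2),(z^3,z^5;z^3,1),(z^5,z^4;z^2,z^4),(z^2,0;0,z^5)\}$ and $B_4=\{1,(z^5,0;z^6,z^2),(z,z^6;z^4,1),(z^5,z^2;z^5,0),(z^3,z^4;z^6,z^5),(1,1;z^3,z),(1,z;1,z^3),(z,z^2;1,z^5),(z,0;z,z^6)\}$. * $\mathbb{PU}=\mathbb U_{C,\mathcal D}$ with $\mathcal D=\{B_1,B_1^g,B_1^{g^2},B_4^f,(B_4^f)^g,(B_4^f)^{g^2}\}$. **Claim.** $\mathbb{WU}$, $\mathbb{OU}$ and $\mathbb{PU}$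 are affine $\mathrm{SL}(2,8)$-unitals and affine unitals of order $8$; $\flat$ and $\natural$ are parallelisms on each of them; and the six closures $\mathbb U^\pi$, $\mathbb U\in\{\mathbb{WU},\mathbb{OU},\mathbb{PU}\}$, $\pi\in\{\flat,\natural\}$, are pairwise non-isomorphic unitals of order $8$. For each of them $$\mathrm{Aut}(\mathbb U^\pi)=\mathrm{Aut}(\mathbb U^\pi)_{[\infty]}=\mathrm{Aut}(\mathbb U),$$ that is, every automorphism of $\mathbb U^\pi$ fixes the block $[\infty]$, and restriction to the points of $\mathbb U$ is a group isomorphism from $\mathrm{Aut}(\mathbb U^\pi)$ onto $\mathrm{Aut}(\mathbb U)$. -/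

import Mathlib

namespace SL2Unital

/-! ### Designs, affine unitals and their closures

All incidence structures here have containment as incidence: an incidence structure is a
point type `P` together with a set `B` of blocks, each block being a set of points. -/

section Designs

variable {P Q : Type*}

/-- A unital of order `n`: a `2-(n^3+1, n+1, 1)` design. -/
structure IsUnital (n : ℕ) (B : Set (Set P)) : Prop where
  card_points : Nat.card P = n ^ 3 + 1
  card_block : ∀ b ∈ B, b.ncard = n + 1
  joining : ∀ x y : P, x ≠ y → ∃! b, b ∈ B ∧ x ∈ b ∧ y ∈ b

/-- The short blocks: those incident with exactly `n` points. -/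
def shortBlocks (n : ℕ) (B : Set (Set P)) : Set (Set P) :=
  {b | b ∈ B ∧ b.ncard = n}

/-- A parallelism: a partition of the set of all short blocks into `n + 1` parallel classes of
size `n^2 - 1`, the blocks of each class being pairwise non-intersecting. -/
structure IsParallelism (n : ℕ) (B : Set (Set P)) (π : Set (Set (Set P))) : Prop where
  sUnion_eq : ⋃₀ π = shortBlocks n B
  disjoint_classes : π.PairwiseDisjoint id
  card_classes : π.ncard = n + 1
  card_class : ∀ c ∈ π, c.ncard = n ^ 2 - 1
  disjoint_blocks : ∀ c ∈ π, c.PairwiseDisjoint id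

/-- An affine unital of order `n`. -/
structure IsAffineUnital (n : ℕ) (B : Set (Set P)) : Prop where
  two_le : 2 ≤ n
  card_points : Nat.card P = n ^ 3 - n
  card_block : ∀ b ∈ B, b.ncard = n ∨ b.ncard = n + 1
  card_blocks_through : ∀ x : P, {b | b ∈ B ∧ x ∈ b}.ncard = n ^ 2
  joining : ∀ x y : P, x ≠ y → ∃! b, b ∈ B ∧ x ∈ b ∧ y ∈ b
  exists_parallelism : ∃ π, IsParallelism n B π

/-- The block `b`, with the new point of each class containing `b` added to it.  (The new points
are the elements of `π`; long blocks lie in no class and receive no new point.) -/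
def extendBlock (π : Set (Set (Set P))) (b : Set P) : Set (P ⊕ π) :=
  Sum.inl '' b ∪ Sum.inr '' {c : π | b ∈ c.1}

/-- The block `[∞]^π`, consisting of all the new points. -/
def blockAtInfinity (π : Set (Set (Set P))) : Set (P ⊕ π) :=
  Set.range Sum.inr

/-- The block set of the `π`-closure, on the point set `P ⊕ π`. -/
def closureBlocks (B : Set (Set P)) (π : Set (Set (Set P))) : Set (Set (P ⊕ π)) :=
  insert (blockAtInfinity π) (extendBlock π '' B)

/-- Isomorphism of incidence structures: a bijection of the points inducing a bijection of
the block sets. -/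
def IsIsomorphic (B : Set (Set P)) (B' : Set (Set Q)) : Prop :=
  ∃ e : P ≃ Q, ∀ b : Set P, e '' b ∈ B' ↔ b ∈ B

/-- The full automorphism group: all bijections of the point set leaving the block set
invariant. -/
def autGroup (B : Set (Set P)) : Subgroup (Equiv.Perm P) where
  carrier := {σ | ∀ b : Set P, σ '' b ∈ B ↔ b ∈ B}
  one_mem' := by intro b; simp
  mul_mem' := by
    intro σ τ hσ hτ b
    have h : (σ * τ : Equiv.Perm P) '' b = σ '' (τ '' b) := by
      rw [Equiv.Perm.coe_mul, Set.image_comp]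
    rw [h, hσ, hτ]
  inv_mem' := by
    intro σ hσ b
    rw [← hσ]
    have h : σ '' ((σ⁻¹ : Equiv.Perm P) '' b) = b := by
      rw [← Set.image_comp, ← Equiv.Perm.coe_mul]; simp
    rw [h]

/-- The stabilizer of the block `b` in the full automorphism group. -/
def autStabilizer (B : Set (Set P)) (b : Set P) : Subgroup (Equiv.Perm P) where
  carrier := {σ | σ ∈ autGroup B ∧ σ '' b = b}
  one_mem' := ⟨one_mem _, by simp⟩
  mul_mem' := by
    rintro σ τ ⟨hσ, hσb⟩ ⟨hτ, hτb⟩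
    exact ⟨mul_mem hσ hτ, by rw [Equiv.Perm.coe_mul, Set.image_comp, hτb, hσb]⟩
  inv_mem' := by
    rintro σ ⟨hσ, hσb⟩
    refine ⟨inv_mem hσ, ?_⟩
    conv_lhs => rw [← hσb]
    rw [← Set.image_comp, ← Equiv.Perm.coe_mul]; simp

end Designs

/-! ### Affine `SL(2,q)`-unitals and the parallelisms flat and natural -/

/-- The group `SL(2, F)`. -/
abbrev SL2 (F : Type*) [Field F] := Matrix.SpecialLinearGroup (Fin 2) F

section Groups

variable {G : Type*} [Group G]

/-- The right translate `D g`. -/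
def rightTranslate (D : Set G) (g : G) : Set G := (fun x => x * g) '' D

/-- The left translate `g D`. -/
def leftTranslate (g : G) (D : Set G) : Set G := (fun x => g * x) '' D

/-- The conjugate `D ^ h = h⁻¹ D h`. -/
def conjugate (D : Set G) (h : G) : Set G := (fun x => h⁻¹ * x * h) '' D

/-- `D* = {x y⁻¹ | x, y ∈ D, x ≠ y}`. -/
def star (D : Set G) : Set G := (fun x : G × G => x.1 * x.2⁻¹) '' D.offDiag

/-- The members of the system that has to partition `G ∖ {1}`: `S ∖ {1}`, all `T ∖ {1}` with `T` a Sylow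
`p`-subgroup (these are the conjugates of any one of them), and all `D*` with `D ∈ 𝒟`. -/
def piece (p : ℕ) (S : Subgroup G) (𝒟 : Set (Set G)) : Unit ⊕ (Sylow p G ⊕ 𝒟) → Set G
  | .inl _ => (S : Set G) \ {1}
  | .inr (.inl T) => (T : Set G) \ {1}
  | .inr (.inr D) => star D.1

/-- The block set of `𝕌_{S,𝒟}`: all right translates of `S`, of the Sylow `p`-subgroups, and of
the members of `𝒟`. The point set is the group `G` itself. -/
def affineBlocks (p : ℕ) (S : Subgroup G) (𝒟 : Set (Set G)) : Set (Set G) :=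
  {b | ∃ g : G, b = rightTranslate (S : Set G) g} ∪
  {b | ∃ (T : Sylow p G) (g : G), b = rightTranslate (T : Set G) g} ∪
  {b | ∃ D ∈ 𝒟, ∃ g : G, b = rightTranslate D g}

/-- The parallelism `♭`: for each Sylow `p`-subgroup, the class of all its right cosets. -/
def flat (p : ℕ) (G : Type*) [Group G] : Set (Set (Set G)) :=
  {c | ∃ T : Sylow p G, c = {b | ∃ g : G, b = rightTranslate (T : Set G) g}}

/-- The parallelism `♮`: for each Sylow `p`-subgroup, the class of all its left cosets. -/
def natural (p : ℕ) (G : Type*) [Group G] : Set (Set (Set G)) :=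
  {c | ∃ T : Sylow p G, c = {b | ∃ g : G, b = leftTranslate g (T : Set G)}}

end Groups

/-- The pair `(S, 𝒟)` defines an affine `SL(2,q)`-unital, where `q = p ^ e` is the order of the
field `F` of characteristic `p`. -/
structure IsAffineSL2Unital (p : ℕ) {F : Type*} [Field F] (S : Subgroup (SL2 F))
    (𝒟 : Set (Set (SL2 F))) : Prop where
  card_subgroup : Nat.card S = Nat.card F + 1
  one_mem : ∀ D ∈ 𝒟, (1 : SL2 F) ∈ D
  card_arcuate : ∀ D ∈ 𝒟, D.ncard = Nat.card F + 1
  /-- the quotients `x y⁻¹` of distinct elements of `D` are pairwise distinct -/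
  injOn : ∀ D ∈ 𝒟, Set.InjOn (fun x : SL2 F × SL2 F => x.1 * x.2⁻¹) D.offDiag
  /-- the system of pieces is a partition of `G ∖ {1}` -/
  piece_nonempty : ∀ i, (piece p S 𝒟 i).Nonempty
  piece_disjoint : Pairwise fun i j => Disjoint (piece p S 𝒟 i) (piece p S 𝒟 j)
  iUnion_piece : ⋃ i, piece p S 𝒟 i = {1}ᶜ

/-! ### Weihnachtsunital, Osterunital and Pfingstunital

Here `F` is a field with `8` elements and `z` a generator of its multiplicative group with
`z ^ 3 = z + 1`. -/

section Order8

variable {F : Type*} [Field F]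

/-- The elements of `SL(2, F)` whose matrix lies in `s`. -/
def ofMatrices (s : Set (Matrix (Fin 2) (Fin 2) F)) : Set (SL2 F) :=
  {A | (A : Matrix (Fin 2) (Fin 2) F) ∈ s}

/-- The set `D₁` of the Weihnachtsunital. -/
def wuD1 (z : F) : Set (SL2 F) := ofMatrices
  {1, !![z^5, 1; z^5, z^6], !![z^4, z^2; 1, z^2], !![0, z; z^6, z^2], !![1, z^4; z^2, z^2],
    !![1, z; z^6, 0], !![1, z^2; 1, z^6], !![z^4, 1; z^5, 1], !![z^5, 0; 0, z^2]}

/-- The set `D₄` of the Weihnachtsunital. -/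
def wuD4 (z : F) : Set (SL2 F) := ofMatrices
  {1, !![z^5, 0; z^6, z^2], !![z, z^6; z^4, 1], !![0, z; z^6, z^5], !![z^4, 0; z^2, z^3],
    !![z^5, z^2; z^3, z^6], !![0, z^2; z^5, z^5], !![0, z^4; z^3, z^4], !![z^2, z^5; z^5, z^6]}

/-- The set `D₁` of the Osterunital. -/
def ouD1 (z : F) : Set (SL2 F) := ofMatrices
  {1, !![z^5, 1; z^5, z^6], !![z^4, z^2; 1, z^2], !![1, z; z^6, 0], !![0, z; z^6, z^2],
    !![1, z^4; z^2, z^2], !![z^3, z^5; z^3, 1], !![z^5, z^4; z^2, z^4], !![z^2, 0; 0, z^5]}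

/-- The set `D₄` of the Osterunital. -/
def ouD4 (z : F) : Set (SL2 F) := ofMatrices
  {1, !![z^5, 0; z^6, z^2], !![z, z^6; z^4, 1], !![z^5, z^2; z^5, 0], !![z^3, z^4; z^6, z^5],
    !![1, 1; z^3, z], !![1, z; 1, z^3], !![z, z^2; 1, z^5], !![z, 0; z, z^6]}

variable [CharP F 2]

theorem det_gen {z : F} (hz : z ^ 3 = z + 1) : (!![z^2, z^4; z^4, z]).det = 1 := by
  have h2 : (2 : F) = 0 := CharTwo.two_eq_zero
  rw [Matrix.det_fin_two_of]
  linear_combination (-z ^ 5 - z ^ 3 - z ^ 2 - z - 1) * hz - (z ^ 2 + z + 1) * h2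

/-- The matrix `g`. -/
def gen (z : F) (hz : z ^ 3 = z + 1) : SL2 F := ⟨!![z^2, z^4; z^4, z], det_gen hz⟩

theorem det_flip : (!![(0 : F), 1; 1, 0]).det = 1 := by
  simp [Matrix.det_fin_two_of, CharTwo.neg_eq]

variable (F) in
/-- The matrix `f`. -/
def flip : SL2 F := ⟨!![0, 1; 1, 0], det_flip⟩

/-- The cyclic group `C = ⟨g⟩`. -/
def cyclicC (z : F) (hz : z ^ 3 = z + 1) : Subgroup (SL2 F) := Subgroup.zpowers (gen z hz)

/-- The image `D · φ` of `D` under the Frobenius automorphism, applied entrywise. -/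
def frob (D : Set (SL2 F)) : Set (SL2 F) :=
  Matrix.SpecialLinearGroup.map (frobenius F 2) '' D

/-- Names for the three affine unitals. -/
inductive AffineName
  | WU
  | OU
  | PU

/-- Names for the two parallelisms. -/
inductive ParallelismName
  | flat
  | natural

/-- The systems `𝒟 = {D₁, …, D₆}` defining the three affine unitals. -/
def arcuate (z : F) (hz : z ^ 3 = z + 1) : AffineName → Set (Set (SL2 F))
  | .WU => {wuD1 z, frob (wuD1 z), frob (frob (wuD1 z)),
      wuD4 z, frob (wuD4 z), frob (frob (wuD4 z))}
  | .OU => {ouD1 z, conjugate (ouD1 z) (gen z hz), conjugate (ouD1 z) (gen z hz ^ 2),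
      ouD4 z, conjugate (ouD4 z) (gen z hz), conjugate (ouD4 z) (gen z hz ^ 2)}
  | .PU => {ouD1 z, conjugate (ouD1 z) (gen z hz), conjugate (ouD1 z) (gen z hz ^ 2),
      conjugate (ouD4 z) (flip F), conjugate (conjugate (ouD4 z) (flip F)) (gen z hz),
      conjugate (conjugate (ouD4 z) (flip F)) (gen z hz ^ 2)}

/-- The block sets of the affine unitals `𝕎𝕌`, `𝕆𝕌`, `ℙ𝕌` on the point set `SL(2, F)`. -/
def blocks (z : F) (hz : z ^ 3 = z + 1) (U : AffineName) : Set (Set (SL2 F)) :=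
  affineBlocks 2 (cyclicC z hz) (arcuate z hz U)

variable (F) in
/-- The two parallelisms on `SL(2, F)`. -/
def parallelism : ParallelismName → Set (Set (Set (SL2 F)))
  | .flat => flat 2 (SL2 F)
  | .natural => natural 2 (SL2 F)

end Order8

end SL2Unital

namespace SL2Unital

/-! ### Closures of affine unitals: restriction and extension of isomorphisms, twins -/

section Closure

variable {P Q : Type*} {B : Set (Set P)} {B' : Set (Set Q)}
  {π : Set (Set (Set P))} {π' : Set (Set (Set Q))}

@[simp] theorem inl_mem_extendBlock {x : P} {b : Set P} :
    Sum.inl x ∈ extendBlock π b ↔ x ∈ b := by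
  simp [extendBlock]

@[simp] theorem inr_mem_extendBlock {c : π} {b : Set P} :
    Sum.inr c ∈ extendBlock π b ↔ b ∈ c.1 := by
  simp [extendBlock]

@[simp] theorem inl_notMem_blockAtInfinity {x : P} : Sum.inl x ∉ blockAtInfinity π := by
  simp [blockAtInfinity]

@[simp] theorem inr_mem_blockAtInfinity {c : π} : Sum.inr c ∈ blockAtInfinity π := by
  simp [blockAtInfinity]

theorem blockAtInfinity_mem : blockAtInfinity π ∈ closureBlocks B π := Set.mem_insert _ _

theorem extendBlock_mem {b : Set P} (hb : b ∈ B) : extendBlock π b ∈ closureBlocks B π :=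
  Set.mem_insert_of_mem _ ⟨b, hb, rfl⟩

theorem eq_or_exists_of_mem_closureBlocks {c : Set (P ⊕ π)} (hc : c ∈ closureBlocks B π) :
    c = blockAtInfinity π ∨ ∃ b ∈ B, c = extendBlock π b := by
  rcases hc with h | ⟨b, hb, rfl⟩
  · exact Or.inl h
  · exact Or.inr ⟨b, hb, rfl⟩

theorem IsParallelism.mem_blocks {n : ℕ} (hπ : IsParallelism n B π) {c : Set (Set P)} (hc : c ∈ π)
    {b : Set P} (hb : b ∈ c) : b ∈ B ∧ b.ncard = n := by
  have h : b ∈ ⋃₀ π := ⟨c, hc, hb⟩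
  rwa [hπ.sUnion_eq] at h

theorem IsParallelism.class_unique {n : ℕ} (hπ : IsParallelism n B π) {c c' : Set (Set P)}
    (hc : c ∈ π) (hc' : c' ∈ π) {b : Set P} (hb : b ∈ c) (hb' : b ∈ c') : c = c' := by
  by_contra h
  exact Set.disjoint_left.1 (hπ.disjoint_classes hc hc' h) hb hb'

/-- The closure of an affine unital is a unital. -/
theorem isUnital_closure {n : ℕ} (hU : IsAffineUnital n B) (hπ : IsParallelism n B π)
    (hcover : ∀ c ∈ π, ∀ x, ∃ b ∈ c, x ∈ b) : IsUnital n (closureBlocks B π) := by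
  have hn := hU.two_le
  have hlt : n < n ^ 3 := by
    calc n = n ^ 1 := (pow_one n).symm
      _ < n ^ 3 := Nat.pow_lt_pow_right (by omega) (by omega)
  have : Finite P := Nat.finite_of_card_ne_zero (by rw [hU.card_points]; omega)
  have hfin : Finite π := by
    apply Nat.finite_of_card_ne_zero
    rw [Nat.card_coe_set_eq, hπ.card_classes]; omega
  have hinf : (blockAtInfinity π).ncard = n + 1 := by
    rw [blockAtInfinity, ← Set.image_univ, Set.ncard_image_of_injective _ Sum.inr_injective,
      Set.ncard_univ, Nat.card_coe_set_eq, hπ.card_classes]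
  refine ⟨?_, ?_, ?_⟩
  · rw [Nat.card_sum, hU.card_points, Nat.card_coe_set_eq, hπ.card_classes]; omega
  · intro c hc
    rcases eq_or_exists_of_mem_closureBlocks hc with rfl | ⟨b, hb, rfl⟩
    · exact hinf
    · have hdisj : Disjoint (Sum.inl '' b : Set (P ⊕ π)) (Sum.inr '' {c : π | b ∈ c.1}) := by
        rw [Set.disjoint_left]; rintro _ ⟨x, _, rfl⟩ ⟨y, _, h⟩; cases h
      rw [extendBlock, Set.ncard_union_eq hdisj, Set.ncard_image_of_injective _ Sum.inl_injective,
        Set.ncard_image_of_injective _ Sum.inr_injective]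
      rcases hU.card_block b hb with h | h
      · have hs : b ∈ ⋃₀ π := by rw [hπ.sUnion_eq]; exact ⟨hb, h⟩
        obtain ⟨c, hc, hbc⟩ := hs
        have : {c : π | b ∈ c.1} = {⟨c, hc⟩} := by
          ext c'
          simp only [Set.mem_ofPred_eq, Set.mem_singleton_iff]
          refine ⟨fun h' => Subtype.ext (hπ.class_unique c'.2 hc h' hbc), ?_⟩
          rintro rfl; exact hbc
        rw [this, Set.ncard_singleton, h]
      · have : {c : π | b ∈ c.1} = ∅ := by
          ext c'
          simp only [Set.mem_ofPred_eq, Set.mem_empty_iff_false, iff_false]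
          intro h'
          have := (hπ.mem_blocks c'.2 h').2
          omega
        rw [this, Set.ncard_empty, h]
  -- An affine point and a new point are joined by the unique block of the class through that point;
  -- `hcover` supplies it and disjointness within the class makes it unique.
  · have key : ∀ (x : P) (c : π), ∃! b, b ∈ closureBlocks B π ∧ Sum.inl x ∈ b ∧ Sum.inr c ∈ b := by
      intro x c
      obtain ⟨b, hbc, hxb⟩ := hcover c.1 c.2 x
      refine ⟨extendBlock π b, ⟨extendBlock_mem (hπ.mem_blocks c.2 hbc).1, by simpa, by simpa⟩, ?_⟩
      rintro e ⟨he, hxe, hce⟩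
      rcases eq_or_exists_of_mem_closureBlocks he with rfl | ⟨b', hb', rfl⟩
      · simp at hxe
      · simp only [inl_mem_extendBlock, inr_mem_extendBlock] at hxe hce
        by_cases hbb : b' = b
        · rw [hbb]
        · exact absurd hxb (Set.disjoint_left.1 (hπ.disjoint_blocks c.1 c.2 hce hbc hbb) hxe)
    rintro (x | c) (y | c') hne
    · obtain ⟨b, ⟨hb, hx, hy⟩, hu⟩ := hU.joining x y (by rintro rfl; exact hne rfl)
      refine ⟨extendBlock π b, ⟨extendBlock_mem hb, by simpa, by simpa⟩, ?_⟩
      rintro e ⟨he, hxe, hye⟩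
      rcases eq_or_exists_of_mem_closureBlocks he with rfl | ⟨b', hb', rfl⟩
      · simp at hxe
      · rw [hu b' ⟨hb', by simpa using hxe, by simpa using hye⟩]
    · exact key x c'
    · obtain ⟨b, ⟨hb, h1, h2⟩, hu⟩ := key y c
      exact ⟨b, ⟨hb, h2, h1⟩, fun b' ⟨h, h', h''⟩ => hu b' ⟨h, h'', h'⟩⟩
    · refine ⟨blockAtInfinity π, ⟨blockAtInfinity_mem, by simp, by simp⟩, ?_⟩
      rintro e ⟨he, hxe, hye⟩
      rcases eq_or_exists_of_mem_closureBlocks he with rfl | ⟨b', hb', rfl⟩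
      · rfl
      · simp only [inr_mem_extendBlock] at hxe hye
        exact absurd (congrArg Sum.inr (Subtype.ext (hπ.class_unique c.2 c'.2 hxe hye))) hne

/-- An isomorphism of closures that maps the block at infinity to the block at infinity restricts
to an isomorphism of the affine unitals that is compatible with the parallelisms. -/
theorem exists_restriction (hB : ∀ b ∈ B, b.Nonempty) (hB' : ∀ b ∈ B', b.Nonempty)
    (σ : P ⊕ π ≃ Q ⊕ π')
    (hσ : ∀ b, σ '' b ∈ closureBlocks B' π' ↔ b ∈ closureBlocks B π)
    (hinf : σ '' blockAtInfinity π = blockAtInfinity π') :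
    ∃ e : P ≃ Q, (∀ x, σ (Sum.inl x) = Sum.inl (e x)) ∧ (∀ b, e '' b ∈ B' ↔ b ∈ B) ∧
      ∀ (c : π), ∃ c' : π', σ (Sum.inr c) = Sum.inr c' ∧ ∀ b ∈ B, b ∈ c.1 ↔ e '' b ∈ c'.1 := by
  have hr : ∀ c : π, ∃ c' : π', σ (Sum.inr c) = Sum.inr c' := by
    intro c
    have h : σ (Sum.inr c) ∈ blockAtInfinity π' := by
      rw [← hinf]; exact ⟨_, by simp, rfl⟩
    obtain ⟨c', hc'⟩ := h
    exact ⟨c', hc'.symm⟩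
  have hl : ∀ x, ∃ y, σ (Sum.inl x) = Sum.inl y := by
    intro x
    rcases h : σ (Sum.inl x) with y | c'
    · exact ⟨y, rfl⟩
    · have h' : σ (Sum.inl x) ∈ blockAtInfinity π' := by rw [h]; simp
      rw [← hinf] at h'
      obtain ⟨w, hw, hw'⟩ := h'
      rw [σ.injective hw'] at hw
      simp at hw
  have hl' : ∀ y, ∃ x, σ (Sum.inl x) = Sum.inl y := by
    intro y
    rcases h : σ.symm (Sum.inl y) with x | c
    · exact ⟨x, by rw [← h]; simp⟩
    · obtain ⟨c', hc'⟩ := hr c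
      rw [← h] at hc'
      simp at hc'
  choose f hf using hl
  have hbij : Function.Bijective f := by
    refine ⟨fun x y h => ?_, fun y => ?_⟩
    · have := (hf x).trans ((congrArg Sum.inl h).trans (hf y).symm)
      exact Sum.inl_injective (σ.injective this)
    · obtain ⟨x, hx⟩ := hl' y
      exact ⟨x, Sum.inl_injective ((hf x).symm.trans hx)⟩
  let e := Equiv.ofBijective f hbij
  have he : ∀ x, σ (Sum.inl x) = Sum.inl (e x) := hf
  -- Nonemptiness of `b` matters: its image contains an affine point, hence is not the block at
  -- infinity.
  have hext : ∀ b ∈ B, e '' b ∈ B' ∧ σ '' extendBlock π b = extendBlock π' (e '' b) := by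
    intro b hb
    have h1 := (hσ (extendBlock π b)).2 (extendBlock_mem hb)
    rcases eq_or_exists_of_mem_closureBlocks h1 with h | ⟨b', hb', h⟩
    · obtain ⟨x, hx⟩ := hB b hb
      have : σ (Sum.inl x) ∈ σ '' extendBlock π b := ⟨_, by simpa, rfl⟩
      rw [h, he] at this
      simp at this
    · have : e '' b = b' := by
        ext y
        obtain ⟨x, rfl⟩ := e.surjective y
        rw [e.injective.mem_set_image, ← inl_mem_extendBlock (π := π'), ← h, ← he,
          σ.injective.mem_set_image, inl_mem_extendBlock]
      rw [this]; exact ⟨hb', h⟩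
  refine ⟨e, he, fun b => ⟨fun h => ?_, fun h => (hext b h).1⟩, fun c => ?_⟩
  · have h1 : σ '' (σ.symm '' extendBlock π' (e '' b)) ∈ closureBlocks B' π' := by
      rw [Equiv.image_symm_image]
      exact extendBlock_mem h
    rw [hσ] at h1
    rcases eq_or_exists_of_mem_closureBlocks h1 with h2 | ⟨b', hb', h2⟩
    · obtain ⟨y, hy⟩ := hB' _ h
      have h3 : (Sum.inl y : Q ⊕ π') ∈ extendBlock π' (e '' b) := by simpa using hy
      have h4 : extendBlock π' (e '' b) = blockAtInfinity π' := by
        rw [← hinf, ← h2, Equiv.image_symm_image]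
      rw [h4] at h3
      simp at h3
    · have h4 : extendBlock π' (e '' b) = extendBlock π' (e '' b') := by
        rw [← (hext b' hb').2, ← h2, Equiv.image_symm_image]
      have : e '' b = e '' b' := by
        ext y
        rw [← inl_mem_extendBlock (π := π'), h4, inl_mem_extendBlock]
      rw [e.injective.image_injective this]
      exact hb'
  · obtain ⟨c', hc'⟩ := hr c
    refine ⟨c', hc', fun b hb => ?_⟩
    rw [← inr_mem_extendBlock, ← σ.injective.mem_set_image, (hext b hb).2, hc', inr_mem_extendBlock]

/-- On a finite point set, a permutation mapping blocks to blocks is an automorphism. -/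
theorem mem_autGroup_of_forall [Finite P] {σ : Equiv.Perm P} (h : ∀ b ∈ B, σ '' b ∈ B) :
    σ ∈ autGroup B := by
  intro b
  refine ⟨fun hb => ?_, h b⟩
  -- An injective map of the finite set of blocks into itself is onto.
  have himage : Set.image σ '' B = B := by
    refine Set.eq_of_subset_of_ncard_le ?_ ?_
    · rintro _ ⟨b, hb, rfl⟩; exact h b hb
    · rw [Set.ncard_image_of_injective _ σ.injective.image_injective]
  rw [← himage] at hb
  obtain ⟨b', hb', h'⟩ := hb
  rwa [← σ.injective.image_injective h']

/-- The extension to the closure of an affine automorphism that respects the parallelism. -/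
theorem exists_extension [Finite P] {σ : Equiv.Perm P} (hσ : σ ∈ autGroup B)
    (hπ : ∀ c ∈ π, Set.image σ '' c ∈ π) :
    ∃ τ ∈ autGroup (closureBlocks B π), (∀ x, τ (Sum.inl x) = Sum.inl (σ x)) ∧
      (∀ b, τ '' extendBlock π b = extendBlock π (σ '' b)) ∧
      τ '' blockAtInfinity π = blockAtInfinity π := by
  let f : π → π := fun c => ⟨Set.image σ '' c.1, hπ c.1 c.2⟩
  have hfi : Function.Injective f := fun c c' h =>
    Subtype.ext (σ.injective.image_injective.image_injective (congrArg Subtype.val h))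
  let e : Equiv.Perm π := Equiv.ofBijective f (Finite.injective_iff_bijective.1 hfi)
  let τ : Equiv.Perm (P ⊕ π) := Equiv.sumCongr σ e
  have hext : ∀ b, τ '' extendBlock π b = extendBlock π (σ '' b) := by
    intro b
    ext (x | c)
    · obtain ⟨y, rfl⟩ := σ.surjective x
      rw [show (Sum.inl (σ y) : P ⊕ π) = τ (Sum.inl y) from rfl, τ.injective.mem_set_image]
      change _ ↔ Sum.inl (σ y) ∈ _
      simp
    · obtain ⟨d, rfl⟩ := e.surjective c
      rw [show (Sum.inr (e d) : P ⊕ π) = τ (Sum.inr d) from rfl, τ.injective.mem_set_image]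
      change _ ↔ Sum.inr (e d) ∈ _
      simp only [inr_mem_extendBlock]
      change _ ↔ σ '' b ∈ Set.image σ '' d.1
      rw [σ.injective.image_injective.mem_set_image]
  have hinf : τ '' blockAtInfinity π = blockAtInfinity π := by
    ext (x | c)
    · obtain ⟨y, rfl⟩ := σ.surjective x
      rw [show (Sum.inl (σ y) : P ⊕ π) = τ (Sum.inl y) from rfl, τ.injective.mem_set_image]
      change _ ↔ Sum.inl (σ y) ∈ _
      simp
    · obtain ⟨d, rfl⟩ := e.surjective c
      rw [show (Sum.inr (e d) : P ⊕ π) = τ (Sum.inr d) from rfl, τ.injective.mem_set_image]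
      change _ ↔ Sum.inr (e d) ∈ _
      simp
  refine ⟨τ, mem_autGroup_of_forall fun c hc => ?_, fun x => rfl, hext, hinf⟩
  rcases eq_or_exists_of_mem_closureBlocks hc with rfl | ⟨b, hb, rfl⟩
  · rw [hinf]; exact blockAtInfinity_mem
  · rw [hext]; exact extendBlock_mem ((hσ b).2 hb)

/-- If all automorphisms of the closure fix the block at infinity and all automorphisms of the
affine unital respect the parallelism, then restriction is an isomorphism of groups. -/
theorem exists_mulEquiv_autGroup {n : ℕ} [Finite P] (hU : IsAffineUnital n B)
    (hπ : IsParallelism n B π)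
    (hinf : ∀ σ ∈ autGroup (closureBlocks B π), σ '' blockAtInfinity π = blockAtInfinity π)
    (hpar : ∀ σ ∈ autGroup B, ∀ c ∈ π, Set.image σ '' c ∈ π) :
    ∃ Φ : autGroup (closureBlocks B π) ≃* autGroup B,
      ∀ σ (x : P), σ.1 (Sum.inl x) = Sum.inl ((Φ σ).1 x) := by
  have hn := hU.two_le
  have hne : ∀ b ∈ B, b.Nonempty := fun b hb => by
    apply Set.nonempty_of_ncard_ne_zero
    rcases hU.card_block b hb with h | h <;> omega
  have hres := fun σ : autGroup (closureBlocks B π) =>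
    exists_restriction hne hne σ.1 σ.2 (hinf σ.1 σ.2)
  choose φ hφ hφB hφc using hres
  let Φ : autGroup (closureBlocks B π) →* autGroup B := MonoidHom.mk'
    (fun σ => ⟨φ σ, hφB σ⟩) (by
      intro σ τ
      apply Subtype.ext
      ext x
      apply Sum.inl_injective (β := π)
      rw [← hφ]
      change σ.1 (τ.1 (Sum.inl x)) = Sum.inl (φ σ (φ τ x))
      rw [hφ, hφ])
  have hbij : Function.Bijective Φ := by
    constructor
    · rw [injective_iff_map_eq_one]
      intro σ h1
      have hx : ∀ x, φ σ x = x := fun x => by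
        have := congrArg (fun τ : autGroup B => τ.1 x) h1
        exact this
      have him : ∀ b : Set P, φ σ '' b = b := fun b => by
        have : ⇑(φ σ) = id := funext hx
        rw [this, Set.image_id]
      apply Subtype.ext
      ext (x | c)
      · rw [hφ, hx]; rfl
      -- If the restriction is trivial, every affine block is fixed. A class is nonempty, having
      -- $n^2-1\ge3$ blocks, and is determined by any one of them, so its new point is fixed too.
      · obtain ⟨c', hc', hb⟩ := hφc σ c
        have hcn : c.1.ncard ≠ 0 := by
          rw [hπ.card_class c.1 c.2]
          have : 2 ^ 2 ≤ n ^ 2 := Nat.pow_le_pow_left hn 2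
          omega
        obtain ⟨b, hbc⟩ := Set.nonempty_of_ncard_ne_zero hcn
        have := (hb b (hπ.mem_blocks c.2 hbc).1).1 hbc
        rw [him] at this
        rw [hc', Subtype.ext (hπ.class_unique c'.2 c.2 this hbc)]
        rfl
    · intro τ
      obtain ⟨σ, hσ, hx, -⟩ := exists_extension (π := π) τ.2 (hpar τ.1 τ.2)
      refine ⟨⟨σ, hσ⟩, Subtype.ext (Equiv.ext fun x => Sum.inl_injective (β := π) ?_)⟩
      rw [← hx]
      exact (hφ ⟨σ, hσ⟩ x).symm
  exact ⟨MulEquiv.ofBijective Φ hbij, fun σ x => hφ σ x⟩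

/-- For every point `y` outside `L` there is a block `c ≠ L` not through `y`, all of whose points are
joined to `y` by blocks meeting `L`. -/
def HasTwins (B : Set (Set P)) (L : Set P) : Prop :=
  ∀ y ∉ L, ∃ c ∈ B, c ≠ L ∧ y ∉ c ∧ ∀ q ∈ c, ∃ b ∈ B, y ∈ b ∧ q ∈ b ∧ (b ∩ L).Nonempty

theorem HasTwins.image {L : Set P} (h : HasTwins B L) (e : P ≃ Q)
    (he : ∀ b, e '' b ∈ B' ↔ b ∈ B) : HasTwins B' (e '' L) := by
  intro y hy
  obtain ⟨x, rfl⟩ := e.surjective y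
  rw [e.injective.mem_set_image] at hy
  obtain ⟨c, hc, hcL, hxc, hq⟩ := h x hy
  refine ⟨e '' c, (he c).2 hc, fun h' => hcL (e.injective.image_injective h'), ?_, ?_⟩
  · rwa [e.injective.mem_set_image]
  · rintro _ ⟨q, hqc, rfl⟩
    obtain ⟨b, hb, h1, h2, w, hw, hw'⟩ := hq q hqc
    exact ⟨e '' b, (he b).2 hb, ⟨x, h1, rfl⟩, ⟨q, h2, rfl⟩, e w, ⟨w, hw, rfl⟩, ⟨w, hw', rfl⟩⟩

/-- If the block at infinity is the only block with twins, it is mapped to the block at infinity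
by every isomorphism. -/
theorem image_blockAtInfinity (h : HasTwins (closureBlocks B π) (blockAtInfinity π))
    (h' : ∀ b ∈ B', ¬ HasTwins (closureBlocks B' π') (extendBlock π' b)) (σ : P ⊕ π ≃ Q ⊕ π')
    (hσ : ∀ b, σ '' b ∈ closureBlocks B' π' ↔ b ∈ closureBlocks B π) :
    σ '' blockAtInfinity π = blockAtInfinity π' := by
  rcases eq_or_exists_of_mem_closureBlocks ((hσ _).2 (blockAtInfinity_mem (B := B))) with h1 | h1
  · exact h1
  · obtain ⟨b, hb, h2⟩ := h1
    exact absurd (h2 ▸ h.image σ hσ) (h' b hb)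

end Closure

/-! ### An isomorphism invariant of pairs of points -/

section Invariant

variable {P Q : Type*} {B : Set (Set P)} {B' : Set (Set Q)}

/-- The points joined to `x` by a block of size `m`. -/
def nbhd (m : ℕ) (B : Set (Set P)) (x : P) : Set P := {p | ∃ s ∈ B, s.ncard = m ∧ x ∈ s ∧ p ∈ s}

/-- The number of blocks of size `n` through `y` with exactly `k` points joined to `x` by a block of
size `m`. -/
noncomputable def pairInvariant (m n k : ℕ) (B : Set (Set P)) (x y : P) : ℕ :=
  {c | c ∈ B ∧ y ∈ c ∧ c.ncard = n ∧ (c ∩ nbhd m B x).ncard = k}.ncard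

theorem image_nbhd (e : P ≃ Q) (he : ∀ b, e '' b ∈ B' ↔ b ∈ B) (m : ℕ) (x : P) :
    e '' nbhd m B x = nbhd m B' (e x) := by
  ext q
  obtain ⟨p, rfl⟩ := e.surjective q
  rw [e.injective.mem_set_image]
  constructor
  · rintro ⟨s, hs, hm, hx, hp⟩
    exact ⟨e '' s, (he s).2 hs, by rw [Set.ncard_image_of_injective _ e.injective, hm],
      ⟨x, hx, rfl⟩, ⟨p, hp, rfl⟩⟩
  · rintro ⟨s, hs, hm, hx, hp⟩
    obtain ⟨s, rfl⟩ := e.surjective.image_surjective s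
    exact ⟨s, (he s).1 hs, by rwa [Set.ncard_image_of_injective _ e.injective] at hm,
      e.injective.mem_set_image.1 hx, e.injective.mem_set_image.1 hp⟩

theorem pairInvariant_map (e : P ≃ Q) (he : ∀ b, e '' b ∈ B' ↔ b ∈ B) (m n k : ℕ) (x y : P) :
    pairInvariant m n k B' (e x) (e y) = pairInvariant m n k B x y := by
  rw [pairInvariant, pairInvariant, ← Set.ncard_image_of_injective _ e.injective.image_injective]
  congr 1
  ext c
  obtain ⟨c, rfl⟩ := e.surjective.image_surjective c
  rw [e.injective.image_injective.mem_set_image]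
  simp only [Set.mem_ofPred_eq, he, e.injective.mem_set_image,
    Set.ncard_image_of_injective _ e.injective, ← image_nbhd e he, ← Set.image_inter e.injective]

end Invariant

/-! ### Coding `SL(2, 8)` by natural numbers -/

/-- The products in `𝔽₈`, as octal digits; the element `a + b z + c z²` is coded by
`a + 2 b + 4 c`. -/
def mulTable : ℕ := 2821848294356612419217921029917578219971947684264937521152

/-- The products of an element and a pair of elements of `𝔽₈`, in base `64`. -/
def scaleTable : ℕ := 2491315289580553036889395510807763620214774894723864220665925146334883115927788280389982049250924551584771719780946591798832866731327472742207839215798171915766812169250454930465671355735105065838267178470892923930766118655636025276934135278741445654955113328805895007270557443140536573178847505472536141798208959644304894057616033515018243334148806001454887589538434655409499538438539351552859097042343039450187595987878777482930799718241360709000425513975288118906102766935555951435710152669208970755378380321756868366565816448255559585196618533915172075045933005587777476343018657371378203461822728098127527030757229508821105682191965465484048386173645517152726752226585912376503992051868164213476228865274436513122368835842186920756740067054290908947904411323730257204428423263657525663582372474416249216500092970625578355903985266822188259795550753981641237987412363886169343703005915707549289683200193256043896295653376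

/-- Multiplication in the coded field. -/
def fmul (a b : ℕ) : ℕ :=
  Nat.land (Nat.shiftRight mulTable (Nat.mul 3 (Nat.add (Nat.mul 8 a) b))) 7

/-- Multiplication of a coded pair by a coded scalar. -/
def rmul (a r : ℕ) : ℕ :=
  Nat.land (Nat.shiftRight scaleTable (Nat.mul 6 (Nat.add (Nat.mul 64 a) r))) 63

/-- The code of the matrix with entries coded by `a`, `b`, `c`, `d`. -/
def mk (a b c d : ℕ) : ℕ := Nat.add (Nat.add a (Nat.mul 8 b)) (Nat.mul 64 (Nat.add c (Nat.mul 8 d)))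

/-- The first entry. -/
def ea (x : ℕ) : ℕ := Nat.land x 7
/-- The second entry. -/
def eb (x : ℕ) : ℕ := Nat.land (Nat.shiftRight x 3) 7
/-- The third entry. -/
def ec (x : ℕ) : ℕ := Nat.land (Nat.shiftRight x 6) 7
/-- The fourth entry. -/
def ed (x : ℕ) : ℕ := Nat.shiftRight x 9

/-- The coded product of matrices. -/
def cmul (x y : ℕ) : ℕ :=
  Nat.add (Nat.xor (rmul (ea x) (Nat.land y 63)) (rmul (eb x) (Nat.shiftRight y 6)))
    (Nat.mul 64 (Nat.xor (rmul (ec x) (Nat.land y 63)) (rmul (ed x) (Nat.shiftRight y 6))))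

/-- The coded inverse. -/
def cinv (x : ℕ) : ℕ := mk (ed x) (eb x) (ec x) (ea x)

/-- The coded Frobenius automorphism. -/
def cfrob (x : ℕ) : ℕ :=
  mk (fmul (ea x) (ea x)) (fmul (eb x) (eb x)) (fmul (ec x) (ec x)) (fmul (ed x) (ed x))

/-- The coded trace of a product. -/
def ctr (x y : ℕ) : ℕ :=
  Nat.xor (Nat.xor (fmul (ea x) (ea y)) (fmul (eb x) (ec y)))
    (Nat.xor (fmul (ec x) (eb y)) (fmul (ed x) (ed y)))

/-- The coded determinant. -/
def cdet (x : ℕ) : ℕ := Nat.xor (fmul (ea x) (ed x)) (fmul (eb x) (ec x))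

/-- The codes of the elements of `SL(2, 8)`. -/
def elems : List ℕ := (List.range 4096).filter fun x => Nat.beq (cdet x) 1

/-- `z` is an element of the field with `8` elements with `z ^ 3 = z + 1`. -/
class IsRoot8 {F : Type*} [Field F] [CharP F 2] (z : F) : Prop where
  card : Nat.card F = 8
  eq : z ^ 3 = z + 1

/-! ### The coded field -/

section Field

/-- The formulas for the bits are the product of two quadratic polynomials in $z$ reduced by
$z^3=z+1$ and $z^4=z^2+z$; they tie the table to the field. -/
theorem fmul_bits : ∀ a < 8, ∀ b < 8, fmul a b < 8 ∧
    fmul a b % 2 = ((a % 2) * (b % 2) + (a / 2 % 2) * (b / 4 % 2) + (a / 4 % 2) * (b / 2 % 2)) % 2 ∧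
    fmul a b / 2 % 2 = ((a % 2) * (b / 2 % 2) + (a / 2 % 2) * (b % 2) + (a / 2 % 2) * (b / 4 % 2) +
      (a / 4 % 2) * (b / 2 % 2) + (a / 4 % 2) * (b / 4 % 2)) % 2 ∧
    fmul a b / 4 % 2 = ((a % 2) * (b / 4 % 2) + (a / 2 % 2) * (b / 2 % 2) + (a / 4 % 2) * (b % 2) +
      (a / 4 % 2) * (b / 4 % 2)) % 2 := by decide +kernel

theorem xor_bits : ∀ a < 8, ∀ b < 8, Nat.xor a b < 8 ∧
    Nat.xor a b % 2 = (a % 2 + b % 2) % 2 ∧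
    Nat.xor a b / 2 % 2 = (a / 2 % 2 + b / 2 % 2) % 2 ∧
    Nat.xor a b / 4 % 2 = (a / 4 % 2 + b / 4 % 2) % 2 := by decide +kernel

theorem exists_fmul_eq_one : ∀ a < 8, a ≠ 0 → ∃ b < 8, fmul a b = 1 := by decide +kernel

theorem xor_eq_zero : ∀ a < 8, ∀ b < 8, Nat.xor a b = 0 → a = b := by decide +kernel

variable {F : Type*} [Field F]

/-- The field element coded by `n`. -/
def dec (z : F) (n : ℕ) : F :=
  ((n % 2 : ℕ) : F) + ((n / 2 % 2 : ℕ) : F) * z + ((n / 4 % 2 : ℕ) : F) * z ^ 2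

variable {z : F}

theorem dec_zero : dec z 0 = 0 := by simp [dec]
theorem dec_one : dec z 1 = 1 := by simp [dec]
theorem dec_two : dec z 2 = z := by simp [dec]
theorem dec_four : dec z 4 = z ^ 2 := by simp [dec]

/-- The code of a field element. -/
noncomputable def enc (z x : F) : ℕ := (Function.invFun (fun n : Fin 8 => dec z n) x : Fin 8)

theorem enc_lt (x : F) : enc z x < 8 := Fin.is_lt _

variable [CharP F 2]

theorem dec_xor {a b : ℕ} (ha : a < 8) (hb : b < 8) :
    dec z (Nat.xor a b) = dec z a + dec z b := by
  obtain ⟨-, h0, h1, h2⟩ := xor_bits a ha b hb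
  rw [dec, h0, h1, h2, ← CharP.cast_eq_mod, ← CharP.cast_eq_mod, ← CharP.cast_eq_mod, dec, dec]
  push_cast
  ring

variable [hz : IsRoot8 z]

theorem dec_fmul {a b : ℕ} (ha : a < 8) (hb : b < 8) :
    dec z (fmul a b) = dec z a * dec z b := by
  obtain ⟨-, h0, h1, h2⟩ := fmul_bits a ha b hb
  rw [dec, h0, h1, h2, ← CharP.cast_eq_mod, ← CharP.cast_eq_mod, ← CharP.cast_eq_mod, dec, dec]
  push_cast
  generalize ((a % 2 : ℕ) : F) = a0
  generalize ((a / 2 % 2 : ℕ) : F) = a1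
  generalize ((a / 4 % 2 : ℕ) : F) = a2
  generalize ((b % 2 : ℕ) : F) = b0
  generalize ((b / 2 % 2 : ℕ) : F) = b1
  generalize ((b / 4 % 2 : ℕ) : F) = b2
  linear_combination (-(a1 * b2 + a2 * b1) - a2 * b2 * z) * hz.eq

theorem dec_three : dec z 3 = z ^ 3 := by simp [dec, hz.eq]; ring
theorem dec_six : dec z 6 = z ^ 4 := by
  simp [dec]; linear_combination (-z) * hz.eq
theorem dec_seven : dec z 7 = z ^ 5 := by
  simp [dec]; linear_combination (-z ^ 2 - 1) * hz.eq
theorem dec_five : dec z 5 = z ^ 6 := by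
  have h2 : (2 : F) = 0 := CharTwo.two_eq_zero
  simp [dec]; linear_combination (-z ^ 3 - z - 1) * hz.eq - z * h2

/-- If the codes differed, their sum would be a nonzero code decoding to 0; multiplying by its coded
inverse would give $1=0$ in $F$. -/
theorem dec_injOn {a b : ℕ} (ha : a < 8) (hb : b < 8) (h : dec z a = dec z b) : a = b := by
  refine xor_eq_zero a ha b hb ?_
  by_contra h0
  obtain ⟨c, hc, h1⟩ := exists_fmul_eq_one _ (xor_bits a ha b hb).1 h0
  have h2 := dec_fmul (z := z) (xor_bits a ha b hb).1 hc
  rw [h1, dec_xor ha hb, h, CharTwo.add_self_eq_zero, zero_mul, dec_one] at h2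
  exact one_ne_zero h2

theorem dec_bijective : Function.Bijective fun n : Fin 8 => dec z n := by
  have : Finite F := Nat.finite_of_card_ne_zero (by rw [hz.card]; omega)
  refine (Nat.bijective_iff_injective_and_card _).2 ⟨fun a b h => ?_, ?_⟩
  · exact Fin.ext (dec_injOn a.2 b.2 h)
  · rw [hz.card, Nat.card_eq_fintype_card, Fintype.card_fin]

theorem dec_enc (x : F) : dec z (enc z x) = x :=
  Function.invFun_eq (f := fun n : Fin 8 => dec z n) (dec_bijective.2 x)

theorem enc_eq_iff {x : F} {a : ℕ} (ha : a < 8) : enc z x = a ↔ x = dec z a := by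
  constructor
  · rintro rfl; exact (dec_enc x).symm
  · rintro rfl; exact dec_injOn (enc_lt _) ha (dec_enc _)

theorem enc_add (x y : F) : enc z (x + y) = Nat.xor (enc z x) (enc z y) := by
  rw [enc_eq_iff (xor_bits _ (enc_lt _) _ (enc_lt _)).1, dec_xor (enc_lt _) (enc_lt _), dec_enc,
    dec_enc]

theorem enc_mul (x y : F) : enc z (x * y) = fmul (enc z x) (enc z y) := by
  rw [enc_eq_iff (fmul_bits _ (enc_lt _) _ (enc_lt _)).1, dec_fmul (enc_lt _) (enc_lt _), dec_enc,
    dec_enc]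

theorem enc_zero : enc z 0 = 0 := by rw [enc_eq_iff (by norm_num), dec_zero]
theorem enc_one : enc z 1 = 1 := by rw [enc_eq_iff (by norm_num), dec_one]

end Field

/-! ### The coded group -/

section Code

/-- Ties `scaleTable` to `mulTable`; a product of matrices then costs four lookups of scaled rows.
-/
theorem rmul_eq : ∀ a < 8, ∀ e < 8, ∀ f < 8,
    rmul a (e + 8 * f) = fmul a e + 8 * fmul a f := by decide +kernel

theorem xor_eq : ∀ a < 8, ∀ b < 8, ∀ c < 8, ∀ d < 8,
    Nat.xor (a + 8 * b) (c + 8 * d) = Nat.xor a c + 8 * Nat.xor b d := by decide +kernel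

theorem entries_mk {a b c d : ℕ} (ha : a < 8) (hb : b < 8) (hc : c < 8) :
    ea (mk a b c d) = a ∧ eb (mk a b c d) = b ∧ ec (mk a b c d) = c ∧ ed (mk a b c d) = d ∧
      Nat.land (mk a b c d) 63 = a + 8 * b ∧ Nat.shiftRight (mk a b c d) 6 = c + 8 * d := by
  have hm : mk a b c d = a + 8 * b + 64 * (c + 8 * d) := rfl
  have h7 : ∀ x, Nat.land x 7 = x % 8 := fun x => Nat.and_two_pow_sub_one_eq_mod x 3
  have h63 : ∀ x, Nat.land x 63 = x % 64 := fun x => Nat.and_two_pow_sub_one_eq_mod x 6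
  have h3 : ∀ x, Nat.shiftRight x 3 = x / 8 := fun x => Nat.shiftRight_eq_div_pow x 3
  have h6 : ∀ x, Nat.shiftRight x 6 = x / 64 := fun x => Nat.shiftRight_eq_div_pow x 6
  have h9 : ∀ x, Nat.shiftRight x 9 = x / 512 := fun x => Nat.shiftRight_eq_div_pow x 9
  simp only [ea, eb, ec, ed, h7, h63, h3, h6, h9, hm]
  omega

theorem mk_injective {a b c d a' b' c' d' : ℕ} (ha : a < 8) (hb : b < 8) (hc : c < 8)
    (ha' : a' < 8) (hb' : b' < 8) (hc' : c' < 8)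
    (h : mk a b c d = mk a' b' c' d') : a = a' ∧ b = b' ∧ c = c' ∧ d = d' := by
  have hm : ∀ a b c d, mk a b c d = a + 8 * b + 64 * (c + 8 * d) := fun _ _ _ _ => rfl
  rw [hm, hm] at h
  omega

theorem exists_mk {n : ℕ} (hn : n < 4096) :
    ∃ a < 8, ∃ b < 8, ∃ c < 8, ∃ d < 8, n = mk a b c d := by
  have hm : ∀ a b c d, mk a b c d = a + 8 * b + 64 * (c + 8 * d) := fun _ _ _ _ => rfl
  refine ⟨n % 8, by omega, n / 8 % 8, by omega, n / 64 % 8, by omega, n / 512, by omega, ?_⟩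
  rw [hm]; omega

theorem cmul_mk {a b c d a' b' c' d' : ℕ} (ha : a < 8) (hb : b < 8) (hc : c < 8) (hd : d < 8)
    (ha' : a' < 8) (hb' : b' < 8) (hc' : c' < 8) (hd' : d' < 8) :
    cmul (mk a b c d) (mk a' b' c' d') =
      mk (Nat.xor (fmul a a') (fmul b c')) (Nat.xor (fmul a b') (fmul b d'))
        (Nat.xor (fmul c a') (fmul d c')) (Nat.xor (fmul c b') (fmul d d')) := by
  obtain ⟨h1, h2, h3, h4, -, -⟩ := entries_mk (d := d) ha hb hc
  obtain ⟨-, -, -, -, h5, h6⟩ := entries_mk (d := d') ha' hb' hc'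
  have hf : ∀ {x y}, x < 8 → y < 8 → fmul x y < 8 := fun hx hy => (fmul_bits _ hx _ hy).1
  rw [cmul, h1, h2, h3, h4, h5, h6, rmul_eq _ ha _ ha' _ hb', rmul_eq _ hb _ hc' _ hd',
    rmul_eq _ hc _ ha' _ hb', rmul_eq _ hd _ hc' _ hd', xor_eq _ (hf ha ha') _ (hf ha hb') _
    (hf hb hc') _ (hf hb hd'), xor_eq _ (hf hc ha') _ (hf hc hb') _ (hf hd hc') _ (hf hd hd')]
  rfl

variable {F : Type*} [Field F]

/-- The code of an element of `SL(2, 8)`. -/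
noncomputable def code (z : F) (A : SL2 F) : ℕ :=
  mk (enc z (A 0 0)) (enc z (A 0 1)) (enc z (A 1 0)) (enc z (A 1 1))

theorem entries_code (z : F) (A : SL2 F) : ea (code z A) = enc z (A 0 0) ∧ eb (code z A) = enc z (A 0 1) ∧
    ec (code z A) = enc z (A 1 0) ∧ ed (code z A) = enc z (A 1 1) := by
  obtain ⟨h1, h2, h3, h4, -, -⟩ := entries_mk (enc_lt (z := z) (A 0 0)) (enc_lt (z := z) (A 0 1))
    (enc_lt (z := z) (A 1 0)) (d := enc z (A 1 1))
  exact ⟨h1, h2, h3, h4⟩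

variable [CharP F 2] {z : F}

theorem code_inv (A : SL2 F) : code z A⁻¹ = cinv (code z A) := by
  obtain ⟨h1, h2, h3, h4⟩ := entries_code z A
  rw [cinv, h1, h2, h3, h4, code, Matrix.SpecialLinearGroup.SL2_inv_expl]
  simp [CharTwo.neg_eq]

variable [hz : IsRoot8 z]

theorem code_eq_mk_iff {A : SL2 F} {a b c d : ℕ} (ha : a < 8) (hb : b < 8) (hc : c < 8)
    (hd : d < 8) : code z A = mk a b c d ↔
      A 0 0 = dec z a ∧ A 0 1 = dec z b ∧ A 1 0 = dec z c ∧ A 1 1 = dec z d := by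
  rw [← enc_eq_iff ha, ← enc_eq_iff hb, ← enc_eq_iff hc, ← enc_eq_iff hd]
  constructor
  · exact mk_injective (enc_lt _) (enc_lt _) (enc_lt _) ha hb hc
  · rintro ⟨h1, h2, h3, h4⟩; rw [code, h1, h2, h3, h4]

theorem code_injective : Function.Injective (code z) := by
  intro A B h
  obtain ⟨h1, h2, h3, h4⟩ := (code_eq_mk_iff (enc_lt _) (enc_lt _) (enc_lt _) (enc_lt _)).1 h
  simp only [dec_enc] at h1 h2 h3 h4
  ext i j
  fin_cases i <;> fin_cases j <;> assumption

theorem code_mul (A B : SL2 F) : code z (A * B) = cmul (code z A) (code z B) := by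
  rw [code, code, code, cmul_mk (enc_lt _) (enc_lt _) (enc_lt _) (enc_lt _) (enc_lt _) (enc_lt _)
    (enc_lt _) (enc_lt _)]
  simp only [Matrix.SpecialLinearGroup.coe_mul, Matrix.mul_apply, Fin.sum_univ_two, enc_add,
    enc_mul]

/-- The literal 513 that stands for the identity in all coded checks is $1+512$. -/
theorem code_one : code z 1 = 513 := by
  simp [code, enc_one, enc_zero, mk]

theorem code_frobenius (A : SL2 F) :
    code z (Matrix.SpecialLinearGroup.map (frobenius F 2) A) = cfrob (code z A) := by
  obtain ⟨h1, h2, h3, h4⟩ := entries_code z A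
  rw [cfrob, h1, h2, h3, h4, code]
  simp only [← enc_mul, ← sq]
  rfl

theorem ctr_code (A B : SL2 F) :
    ctr (code z A) (code z B) = enc z ((A * B : SL2 F) 0 0 + (A * B : SL2 F) 1 1) := by
  obtain ⟨h1, h2, h3, h4⟩ := entries_code z A
  obtain ⟨h5, h6, h7, h8⟩ := entries_code z B
  simp only [ctr, h1, h2, h3, h4, h5, h6, h7, h8, ← enc_mul, ← enc_add,
    Matrix.SpecialLinearGroup.coe_mul, Matrix.mul_apply, Fin.sum_univ_two]

theorem mem_elems {n : ℕ} : n ∈ elems ↔ n < 4096 ∧ cdet n = 1 := by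
  simp [elems]

theorem code_mem_elems (A : SL2 F) : code z A ∈ elems := by
  obtain ⟨h1, h2, h3, h4⟩ := entries_code z A
  rw [mem_elems]
  constructor
  · have hm : ∀ a b c d, mk a b c d = a + 8 * b + 64 * (c + 8 * d) := fun _ _ _ _ => rfl
    have h1 := enc_lt (z := z) (A 0 0)
    have h2 := enc_lt (z := z) (A 0 1)
    have h3 := enc_lt (z := z) (A 1 0)
    have h4 := enc_lt (z := z) (A 1 1)
    rw [code, hm]; omega
  · have hd := A.2
    rw [Matrix.det_fin_two, CharTwo.sub_eq_add] at hd
    rw [cdet, h1, h2, h3, h4, ← enc_mul, ← enc_mul, ← enc_add]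
    exact (congrArg _ hd).trans enc_one

theorem exists_code_eq (z : F) [hz : IsRoot8 z] {n : ℕ} (hn : n ∈ elems) :
    ∃ A : SL2 F, code z A = n := by
  rw [mem_elems] at hn
  obtain ⟨a, ha, b, hb, c, hc, d, hd, rfl⟩ := exists_mk hn.1
  obtain ⟨h1, h2, h3, h4, -, -⟩ := entries_mk (d := d) ha hb hc
  have h := hn.2
  rw [cdet, h1, h2, h3, h4] at h
  have hdet : (!![dec z a, dec z b; dec z c, dec z d]).det = 1 := by
    rw [Matrix.det_fin_two_of, CharTwo.sub_eq_add, ← dec_fmul ha hd, ← dec_fmul hb hc,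
      ← dec_xor (fmul_bits _ ha _ hd).1 (fmul_bits _ hb _ hc).1, h, dec_one]
  let A : SL2 F := ⟨!![dec z a, dec z b; dec z c, dec z d], hdet⟩
  exact ⟨A, (code_eq_mk_iff ha hb hc hd).2 ⟨rfl, rfl, rfl, rfl⟩⟩

theorem elems_length : elems.length = 504 := by decide +kernel

theorem elems_nodup : elems.Nodup := List.nodup_range.filter _

theorem card_SL2 (z : F) [hz : IsRoot8 z] : Nat.card (SL2 F) = 504 := by
  let f : SL2 F → {n // n ∈ elems.toFinset} := fun A =>
    ⟨code z A, List.mem_toFinset.2 (code_mem_elems A)⟩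
  have hf : Function.Bijective f := by
    refine ⟨fun A B h => code_injective (congrArg Subtype.val h), fun n => ?_⟩
    obtain ⟨A, hA⟩ := exists_code_eq z (List.mem_toFinset.1 n.2)
    exact ⟨A, Subtype.ext hA⟩
  rw [Nat.card_eq_of_bijective f hf, Nat.card_eq_fintype_card, Fintype.card_coe,
    List.toFinset_card_of_nodup elems_nodup, elems_length]

end Code

/-! ### Coded subsets of `SL(2, 8)` -/

/-- The coded conjugate `m⁻¹ x m`. -/
def cconj (m x : ℕ) : ℕ := cmul (cmul (cinv m) x) m

/-- The list `l` with all entries equal to the code of `1` removed. -/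
def punct (l : List ℕ) : List ℕ := l.filter fun x => !Nat.beq x 513

/-- The line `D d⁻¹`. -/
def lineOf (D : List ℕ) (d : ℕ) : List ℕ := D.map fun x => cmul x (cinv d)

/-- The coded group `C`. -/
def cycL : List ℕ := (List.range 9).map fun i => (cmul (mk 4 6 6 2))^[i] 513

/-- The coded group of upper unitriangular matrices. -/
def upperL : List ℕ := (List.range 8).map fun b => mk 1 b 0 1

/-- The coded Sylow `2`-subgroups. -/
def sylL : List (List ℕ) := upperL :: (List.range 8).map fun t => upperL.map (cconj (mk 0 1 1 t))

/-- The coded set `wuD1`. -/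
def wuL1 : List ℕ := [mk 1 0 0 1, mk 7 1 7 5, mk 6 4 1 4, mk 0 2 5 4, mk 1 6 4 4, mk 1 2 5 0,
  mk 1 4 1 5, mk 6 1 7 1, mk 7 0 0 4]

/-- The coded set `wuD4`. -/
def wuL4 : List ℕ := [mk 1 0 0 1, mk 7 0 5 4, mk 2 5 6 1, mk 0 2 5 7, mk 6 0 4 3, mk 7 4 3 5,
  mk 0 4 7 7, mk 0 6 3 6, mk 4 7 7 5]

/-- The coded set `ouD1`. -/
def ouL1 : List ℕ := [mk 1 0 0 1, mk 7 1 7 5, mk 6 4 1 4, mk 1 2 5 0, mk 0 2 5 4, mk 1 6 4 4,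
  mk 3 7 3 1, mk 7 6 4 6, mk 4 0 0 7]

/-- The coded set `ouD4`. -/
def ouL4 : List ℕ := [mk 1 0 0 1, mk 7 0 5 4, mk 2 5 6 1, mk 7 4 7 0, mk 3 6 5 7, mk 1 1 3 2,
  mk 1 2 1 3, mk 2 4 1 7, mk 2 0 2 5]

/-- The code of `gen`. -/
def genC : ℕ := mk 4 6 6 2

/-- The three conjugates of `D` under powers of `gen`. -/
def conjL (D : List ℕ) : List (List ℕ) := [D, D.map (cconj genC), D.map (cconj (cmul genC genC))]

/-- The three images of `D` under powers of the Frobenius automorphism. -/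
def frobL (D : List ℕ) : List (List ℕ) := [D, D.map cfrob, (D.map cfrob).map cfrob]

/-- The coded systems `arcuate`. -/
def arcL : AffineName → List (List ℕ)
  | .WU => frobL wuL1 ++ frobL wuL4
  | .OU => conjL ouL1 ++ conjL ouL4
  | .PU => conjL ouL1 ++ conjL (ouL4.map (cconj (mk 0 1 1 0)))

/-- The coded blocks through `1`. -/
def lines (U : AffineName) : List (List ℕ) :=
  (cycL :: sylL) ++ (arcL U).flatMap fun D => D.map (lineOf D)

/-- No entry of the list is repeated or among the bits of `m`. -/
def nodupFrom (m : ℕ) : List ℕ → Bool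
  | [] => true
  | a :: l => bif Nat.testBit m a then false else nodupFrom (Nat.lor m (Nat.shiftLeft 1 a)) l

theorem nodupFrom_spec {l : List ℕ} {m : ℕ} (h : nodupFrom m l = true) :
    l.Nodup ∧ ∀ x ∈ l, Nat.testBit m x = false := by
  induction l generalizing m with
  | nil => simp
  | cons a l ih =>
    rw [nodupFrom] at h
    rcases hm : Nat.testBit m a with _ | _
    · rw [hm, cond_false] at h
      obtain ⟨h1, h2⟩ := ih h
      have h3 : ∀ x, Nat.testBit (Nat.lor m (Nat.shiftLeft 1 a)) x =
          (Nat.testBit m x || decide (a = x)) := fun x => by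
        change (m ||| (1 <<< a)).testBit x = _
        rw [Nat.testBit_or, Nat.one_shiftLeft, Nat.testBit_two_pow]
      refine ⟨List.nodup_cons.2 ⟨fun ha => ?_, h1⟩, ?_⟩
      · simpa [h3] using h2 a ha
      · intro x hx
        rcases List.mem_cons.1 hx with rfl | hx
        · exact hm
        · have := h2 x hx
          rw [h3, Bool.or_eq_false_iff] at this
          exact this.1
    · rw [hm, cond_true] at h; cases h

/-- The computation behind the whole design. Together with `master_length` it says that the
punctured blocks through 1 partition $G\smallsetminus\{1\}$, which yields (Q), (P) and the unique
joining of points at once. -/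
theorem master_nodup (U : AffineName) : ((lines U).flatMap punct).Nodup := by
  have h : nodupFrom 0 ((lines U).flatMap punct) = true := by cases U <;> decide +kernel
  exact (nodupFrom_spec h).1

theorem master_length (U : AffineName) : ((lines U).flatMap punct).length = 503 := by
  cases U <;> decide +kernel

/-- `x` is the code of an element of `SL(2, 8)`. -/
def isElem (x : ℕ) : Bool := Nat.blt x 4096 && Nat.beq (cdet x) 1

theorem isElem_iff {x : ℕ} : isElem x = true ↔ x ∈ elems := by
  simp [isElem, mem_elems]

/-- The coded representatives of the blocks under right translations. -/
def bases (U : AffineName) : List (List ℕ) := (cycL :: sylL) ++ arcL U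

theorem bases_spec (U : AffineName) : ∀ D ∈ bases U, (∀ x ∈ D, x ∈ elems) ∧ 513 ∈ D ∧ D.Nodup := by
  have h : (bases U).all (fun D => D.all isElem && D.any (Nat.beq 513) && nodupFrom 0 D) = true := by
    cases U <;> decide +kernel
  intro D hD
  have := List.all_eq_true.1 h D hD
  simp only [Bool.and_eq_true, List.all_eq_true, List.any_eq_true, Nat.beq_eq] at this
  obtain ⟨⟨h1, x, hx, rfl⟩, h3⟩ := this
  exact ⟨fun x hx => isElem_iff.1 (h1 x hx), hx, (nodupFrom_spec h3).1⟩

theorem lines_spec (U : AffineName) : ∀ l ∈ lines U, (∀ x ∈ l, x ∈ elems) ∧ 513 ∈ l ∧ l.Nodup := by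
  have h : (lines U).all (fun D => D.all isElem && D.any (Nat.beq 513) && nodupFrom 0 D) = true := by
    cases U <;> decide +kernel
  intro D hD
  have := List.all_eq_true.1 h D hD
  simp only [Bool.and_eq_true, List.all_eq_true, List.any_eq_true, Nat.beq_eq] at this
  obtain ⟨⟨h1, x, hx, rfl⟩, h3⟩ := this
  exact ⟨fun x hx => isElem_iff.1 (h1 x hx), hx, (nodupFrom_spec h3).1⟩

theorem arcL_length (U : AffineName) : ∀ D ∈ arcL U, D.length = 9 := by
  cases U <;> decide +kernel

theorem sylL_length : ∀ l ∈ sylL, l.length = 8 := by decide +kernel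

theorem cycL_length : cycL.length = 9 := by decide +kernel

/-- By Sylow's conjugacy theorem this identifies the listed sets with the Sylow 2-subgroups. -/
theorem sylL_conj : ∀ g ∈ elems, ∃ l ∈ sylL, ∀ x ∈ upperL, cconj g x ∈ l := by
  have h : (elems.all fun g => sylL.any fun l => upperL.all fun x =>
    l.any (Nat.beq (cconj g x))) = true := by decide +kernel
  simpa using h

/-- In characteristic 2, determinant 1 and trace 0 mean characteristic polynomial $(X+1)^2$, hence
$x^2=1$. Being joined to 1 by a short block thus becomes a linear condition on the entries. -/
theorem trace_eq_zero_iff : ∀ x ∈ elems, (∃ l ∈ sylL, x ∈ l) ↔ ctr x 513 = 0 := by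
  have h : (elems.all fun x => (sylL.any fun l => l.any (Nat.beq x)) ==
    Nat.beq (ctr x 513) 0) = true := by decide +kernel
  intro x hx
  have := List.all_eq_true.1 h x hx
  rw [beq_iff_eq, Bool.eq_iff_iff] at this
  simpa using this

theorem upperL_mul : ∀ x ∈ upperL, ∀ y ∈ upperL, cmul x y ∈ upperL := by decide +kernel

theorem upperL_inv : ∀ x ∈ upperL, cinv x ∈ upperL := by decide +kernel

/-! ### Coded subsets as subsets of the group; the Sylow 2-subgroups -/

section Sets

variable {F : Type*} [Field F]

/-- The set of all elements with code in `l`. -/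
def lset (z : F) (l : List ℕ) : Set (SL2 F) := {A | code z A ∈ l}

theorem mem_lset {z : F} {l : List ℕ} {A : SL2 F} : A ∈ lset z l ↔ code z A ∈ l := Iff.rfl

variable [CharP F 2]

theorem finite_SL2 (z : F) [IsRoot8 z] : Finite (SL2 F) :=
  Nat.finite_of_card_ne_zero (by rw [card_SL2 z]; norm_num)

variable {z : F} [hz : IsRoot8 z]

theorem ncard_lset {l : List ℕ} (hl : ∀ x ∈ l, x ∈ elems) (hn : l.Nodup) :
    (lset z l).ncard = l.length := by
  rw [← Set.ncard_image_of_injective _ (code_injective (z := z)), ← List.toFinset_card_of_nodup hn,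
    ← Set.ncard_coe_finset]
  congr 1
  ext n
  constructor
  · rintro ⟨A, hA, rfl⟩; simpa [mem_lset] using hA
  · intro hn
    have hn : n ∈ l := by simpa using hn
    obtain ⟨A, rfl⟩ := exists_code_eq z (hl n hn)
    exact ⟨A, hn, rfl⟩

theorem image_lset {l : List ℕ} (hl : ∀ x ∈ l, x ∈ elems) {f : SL2 F → SL2 F} {c : ℕ → ℕ}
    (hf : ∀ A, code z (f A) = c (code z A)) : f '' lset z l = lset z (l.map c) := by
  ext A
  rw [mem_lset, List.mem_map]
  constructor
  · rintro ⟨B, hB, rfl⟩; exact ⟨_, hB, (hf B).symm⟩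
  · rintro ⟨n, hn, h⟩
    obtain ⟨B, rfl⟩ := exists_code_eq z (hl n hn)
    exact ⟨B, hn, code_injective ((hf B).trans h)⟩

theorem rightTranslate_lset {l : List ℕ} (hl : ∀ x ∈ l, x ∈ elems) (g : SL2 F) :
    rightTranslate (lset z l) g = lset z (l.map fun x => cmul x (code z g)) :=
  image_lset hl fun A => code_mul A g

theorem conjugate_lset {l : List ℕ} (hl : ∀ x ∈ l, x ∈ elems) (g : SL2 F) :
    conjugate (lset z l) g = lset z (l.map (cconj (code z g))) :=
  image_lset hl fun A => by rw [code_mul, code_mul, code_inv, cconj]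

theorem frob_lset {l : List ℕ} (hl : ∀ x ∈ l, x ∈ elems) : frob (lset z l) = lset z (l.map cfrob) :=
  image_lset hl fun A => code_frobenius A

theorem code_eq_mk_iff_coe {A : SL2 F} {a b c d : ℕ} {p q r s : F} (ha : a < 8) (hb : b < 8)
    (hc : c < 8) (hd : d < 8) (hp : dec z a = p) (hq : dec z b = q) (hr : dec z c = r)
    (hs : dec z d = s) :
    (A : Matrix (Fin 2) (Fin 2) F) = !![p, q; r, s] ↔ code z A = mk a b c d := by
  rw [code_eq_mk_iff ha hb hc hd, hp, hq, hr, hs, ← Matrix.ext_iff]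
  simp [Fin.forall_fin_two, and_assoc]

theorem code_gen : code z (gen z hz.eq) = genC :=
  (code_eq_mk_iff_coe (by norm_num) (by norm_num) (by norm_num) (by norm_num) dec_four dec_six
    dec_six dec_two).1 rfl

theorem code_flip : code z (flip F) = mk 0 1 1 0 :=
  (code_eq_mk_iff_coe (by norm_num) (by norm_num) (by norm_num) (by norm_num) dec_zero dec_one
    dec_one dec_zero).1 rfl

theorem ofMatrices_eq :
    wuD1 z = lset z wuL1 ∧ wuD4 z = lset z wuL4 ∧ ouD1 z = lset z ouL1 ∧ ouD4 z = lset z ouL4 := by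
  refine ⟨?_, ?_, ?_, ?_⟩ <;> ext A <;>
  simp [wuD1, wuD4, ouD1, ouD4, ofMatrices, wuL1, wuL4, ouL1, ouL4, mem_lset, code_eq_mk_iff,
    dec_zero, dec_one, dec_two, dec_three, dec_four, dec_five, dec_six, dec_seven,
    ← Matrix.ext_iff, Fin.forall_fin_two, and_assoc]

theorem bases_of_mem_arcL {U : AffineName} {D : List ℕ} (hD : D ∈ arcL U) : D ∈ bases U :=
  List.mem_append_right _ hD

theorem arcuate_eq (U : AffineName) :
    arcuate z hz.eq U = {D | ∃ l ∈ arcL U, D = lset z l} := by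
  obtain ⟨h1, h2, h3, h4⟩ := ofMatrices_eq (z := z)
  have e : ∀ U, ∀ l ∈ arcL U, ∀ x ∈ l, x ∈ elems := fun U l hl =>
    (bases_spec U l (bases_of_mem_arcL hl)).1
  have w1 := e .WU wuL1 (by simp [arcL, frobL])
  have w2 := e .WU (wuL1.map cfrob) (by simp [arcL, frobL])
  have w4 := e .WU wuL4 (by simp [arcL, frobL])
  have w5 := e .WU (wuL4.map cfrob) (by simp [arcL, frobL])
  have o1 := e .OU ouL1 (by simp [arcL, conjL])
  have o4 := e .OU ouL4 (by simp [arcL, conjL])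
  have p4 := e .PU (ouL4.map (cconj (mk 0 1 1 0))) (by simp [arcL, conjL])
  have hg : code z (gen z hz.eq ^ 2) = cmul genC genC := by rw [sq, code_mul, code_gen]
  have hg1 := code_gen (z := z)
  have hf := code_flip (z := z)
  ext D
  cases U
  · simp only [arcuate, h1, h2, frob_lset w1, frob_lset w2, frob_lset w4, frob_lset w5]
    simp [arcL, frobL]
  · simp only [arcuate, h3, h4, conjugate_lset o1, conjugate_lset o4, hg, hg1]
    simp [arcL, conjL]
  · simp only [arcuate, h3, h4, conjugate_lset o1, conjugate_lset o4, conjugate_lset p4, hg, hg1, hf]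
    simp [arcL, conjL]

theorem code_gen_pow (i : ℕ) : code z (gen z hz.eq ^ i) = (cmul genC)^[i] 513 := by
  induction i with
  | zero => exact code_one
  | succ i ih => rw [pow_succ', code_mul, ih, code_gen, Function.iterate_succ_apply']

theorem gen_pow_nine : gen z hz.eq ^ 9 = 1 := by
  apply code_injective (z := z)
  rw [code_gen_pow, code_one]
  decide +kernel

theorem coe_cyclicC : (cyclicC z hz.eq : Set (SL2 F)) = lset z cycL := by
  ext A
  rw [SetLike.mem_coe, cyclicC, Subgroup.mem_zpowers_iff, mem_lset, cycL, List.mem_map]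
  constructor
  · rintro ⟨k, rfl⟩
    refine ⟨(k % 9).toNat, by simp; omega, ?_⟩
    have h1 : gen z hz.eq ^ (9 : ℤ) = 1 := by
      rw [← gen_pow_nine (z := z)]; norm_cast
    have h2 : gen z hz.eq ^ k = gen z hz.eq ^ (k % 9).toNat := by
      conv_lhs => rw [← Int.emod_add_mul_ediv k 9, zpow_add, zpow_mul, h1, one_zpow, mul_one,
        ← Int.toNat_of_nonneg (Int.emod_nonneg k (by norm_num : (9 : ℤ) ≠ 0)), zpow_natCast]
    rw [h2, code_gen_pow]; rfl
  · rintro ⟨i, -, h⟩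
    refine ⟨i, code_injective (z := z) ?_⟩
    rw [zpow_natCast, code_gen_pow, ← h]; rfl

theorem mem_bases_of_mem_sylL {l : List ℕ} (U : AffineName) (hl : l ∈ sylL) : l ∈ bases U :=
  List.mem_append_left _ (List.mem_cons_of_mem _ hl)

theorem sylL_spec {l : List ℕ} (hl : l ∈ sylL) : (∀ x ∈ l, x ∈ elems) ∧ 513 ∈ l ∧ l.Nodup :=
  bases_spec .WU l (mem_bases_of_mem_sylL .WU hl)

theorem ncard_sylL {l : List ℕ} (hl : l ∈ sylL) : (lset z l).ncard = 8 := by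
  rw [ncard_lset (sylL_spec hl).1 (sylL_spec hl).2.2, sylL_length l hl]

variable (z) in
/-- The group of upper unitriangular matrices. -/
def upper : Subgroup (SL2 F) where
  carrier := lset z upperL
  one_mem' := by rw [mem_lset, code_one]; decide +kernel
  mul_mem' {A B} hA hB := by rw [mem_lset, code_mul]; exact upperL_mul _ hA _ hB
  inv_mem' {A} hA := by rw [mem_lset, code_inv]; exact upperL_inv _ hA

theorem upperL_mem : upperL ∈ sylL := List.mem_cons_self

variable (z) in
/-- The group of upper unitriangular matrices is a Sylow subgroup. -/
def upperSylow : Sylow 2 (SL2 F) :=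
  have := finite_SL2 z
  Sylow.ofCard (upper z) (by
    have h : Nat.card (upper z) = 8 := ncard_sylL (z := z) upperL_mem
    have h' : (504).factorization 2 = 3 := by
      rw [show 504 = 2 ^ 3 * 63 by norm_num, Nat.factorization_mul (by norm_num) (by norm_num),
        Nat.Prime.factorization_pow Nat.prime_two]
      simp [Nat.factorization_eq_zero_of_not_dvd (show ¬ 2 ∣ 63 by norm_num)]
    rw [h, card_SL2 z, h']; norm_num)

theorem coe_smul_upperSylow (g : SL2 F) :
    ((g⁻¹ • upperSylow z : Sylow 2 (SL2 F)) : Set (SL2 F)) =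
      lset z (upperL.map (cconj (code z g))) := by
  rw [← conjugate_lset (sylL_spec upperL_mem).1]
  ext A
  rw [Sylow.coe_smul, Set.mem_smul_set]
  constructor
  · rintro ⟨B, hB, rfl⟩
    exact ⟨B, hB, by simp [MulAut.smul_def]⟩
  · rintro ⟨B, hB, rfl⟩
    exact ⟨B, hB, by simp [MulAut.smul_def]⟩

theorem exists_coe_sylow_eq (T : Sylow 2 (SL2 F)) : ∃ l ∈ sylL, (T : Set (SL2 F)) = lset z l := by
  have := finite_SL2 z
  obtain ⟨g, rfl⟩ := MulAction.exists_smul_eq (SL2 F) (upperSylow z) T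
  obtain ⟨l, hl, h⟩ := sylL_conj _ (code_mem_elems (z := z) g⁻¹)
  refine ⟨l, hl, ?_⟩
  have h1 := coe_smul_upperSylow (z := z) g⁻¹
  rw [inv_inv] at h1
  rw [h1]
  refine Set.eq_of_subset_of_ncard_le ?_ ?_
  · intro A hA
    obtain ⟨x, hx, h2⟩ := List.mem_map.1 (mem_lset.1 hA)
    rw [mem_lset, ← h2]; exact h x hx
  · rw [ncard_sylL hl, ← conjugate_lset (sylL_spec upperL_mem).1, conjugate,
      Set.ncard_image_of_injective, ncard_sylL upperL_mem]
    intro A B h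
    simpa using h

theorem exists_sylow_coe_eq {l : List ℕ} (hl : l ∈ sylL) :
    ∃ T : Sylow 2 (SL2 F), (T : Set (SL2 F)) = lset z l := by
  rcases List.mem_cons.1 hl with rfl | h
  · exact ⟨upperSylow z, rfl⟩
  · obtain ⟨t, ht, rfl⟩ := List.mem_map.1 h
    have : mk 0 1 1 t ∈ elems := by
      have : ∀ t ∈ List.range 8, isElem (mk 0 1 1 t) = true := by decide +kernel
      exact isElem_iff.1 (this t ht)
    obtain ⟨g, hg⟩ := exists_code_eq z this
    exact ⟨g⁻¹ • upperSylow z, by rw [coe_smul_upperSylow, hg]⟩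

end Sets

/-! ### Translates of subsets of a group -/

section Translates

variable {G : Type*} [Group G]

theorem mem_rightTranslate {D : Set G} {g x : G} : x ∈ rightTranslate D g ↔ x * g⁻¹ ∈ D :=
  ⟨by rintro ⟨y, hy, rfl⟩; simpa using hy, fun h => ⟨_, h, by simp⟩⟩

theorem mem_leftTranslate {D : Set G} {g x : G} : x ∈ leftTranslate g D ↔ g⁻¹ * x ∈ D :=
  ⟨by rintro ⟨y, hy, rfl⟩; simpa using hy, fun h => ⟨_, h, by simp⟩⟩

theorem rightTranslate_rightTranslate (D : Set G) (g h : G) :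
    rightTranslate (rightTranslate D g) h = rightTranslate D (g * h) := by
  ext x; simp [mem_rightTranslate, mul_assoc]

theorem rightTranslate_one (D : Set G) : rightTranslate D 1 = D := by
  ext x; simp [mem_rightTranslate]

theorem rightTranslate_injective (g : G) : Function.Injective fun D => rightTranslate D g :=
  fun D E h => by
    have := congrArg (fun D => rightTranslate D g⁻¹) h
    simpa [rightTranslate_rightTranslate, rightTranslate_one] using this

theorem ncard_rightTranslate (D : Set G) (g : G) : (rightTranslate D g).ncard = D.ncard :=
  Set.ncard_image_of_injective _ (mul_left_injective g)

theorem ncard_leftTranslate (D : Set G) (g : G) : (leftTranslate g D).ncard = D.ncard :=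
  Set.ncard_image_of_injective _ (mul_right_injective g)

theorem rightTranslate_subgroup (H : Subgroup G) {g : G} (hg : g ∈ H) :
    rightTranslate (H : Set G) g = H := by
  ext x
  rw [mem_rightTranslate, SetLike.mem_coe, SetLike.mem_coe, H.mul_mem_cancel_right (H.inv_mem hg)]

theorem rightTranslate_affineBlocks {p : ℕ} {S : Subgroup G} {𝒟 : Set (Set G)} {b : Set G}
    (hb : b ∈ affineBlocks p S 𝒟) (g : G) : rightTranslate b g ∈ affineBlocks p S 𝒟 := by
  rcases hb with (⟨h, rfl⟩ | ⟨T, h, rfl⟩) | ⟨D, hD, h, rfl⟩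
  · exact Or.inl (Or.inl ⟨h * g, rightTranslate_rightTranslate _ _ _⟩)
  · exact Or.inl (Or.inr ⟨T, h * g, rightTranslate_rightTranslate _ _ _⟩)
  · exact Or.inr ⟨D, hD, h * g, rightTranslate_rightTranslate _ _ _⟩

end Translates

/-! ### The blocks through 1 -/

section Lines

theorem mem_punct {l : List ℕ} {x : ℕ} : x ∈ punct l ↔ x ∈ l ∧ x ≠ 513 := by
  rw [punct, List.mem_filter, Bool.not_eq_true', ← Bool.not_eq_true, Nat.beq_eq]

theorem lines_disjoint {U : AffineName} {l l' : List ℕ} (hl : l ∈ lines U) (hl' : l' ∈ lines U)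
    {x : ℕ} (hx : x ∈ l) (hx' : x ∈ l') (h1 : x ≠ 513) : l = l' := by
  by_contra hne
  have h := (List.nodup_flatMap.1 (master_nodup U)).2
  have hs : Std.Symm (Function.onFun List.Disjoint punct) := ⟨fun _ _ h => h.symm⟩
  exact h.forall hl hl' hne (mem_punct.2 ⟨hx, h1⟩) (mem_punct.2 ⟨hx', h1⟩)

/-- By counting: 503 distinct non-identity codes exhaust the 503 non-identity elements. -/
theorem exists_line {U : AffineName} {x : ℕ} (hx : x ∈ elems) (h1 : x ≠ 513) :
    ∃ l ∈ lines U, x ∈ l := by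
  have hsub : ((lines U).flatMap punct).toFinset ⊆ elems.toFinset.erase 513 := by
    intro y hy
    rw [List.mem_toFinset, List.mem_flatMap] at hy
    obtain ⟨l, hl, hy⟩ := hy
    rw [mem_punct] at hy
    rw [Finset.mem_erase, List.mem_toFinset]
    exact ⟨hy.2, (lines_spec U l hl).1 y hy.1⟩
  have h513 : 513 ∈ elems := by rw [← isElem_iff]; decide +kernel
  have heq := Finset.eq_of_subset_of_card_le hsub (by
    rw [Finset.card_erase_of_mem (List.mem_toFinset.2 h513),
      List.toFinset_card_of_nodup elems_nodup, elems_length,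
      List.toFinset_card_of_nodup (master_nodup U), master_length])
  have hx' : x ∈ elems.toFinset.erase 513 := by
    rw [Finset.mem_erase, List.mem_toFinset]; exact ⟨h1, hx⟩
  rw [← heq, List.mem_toFinset, List.mem_flatMap] at hx'
  obtain ⟨l, hl, h⟩ := hx'
  exact ⟨l, hl, (mem_punct.1 h).1⟩

theorem mem_lines {U : AffineName} {l : List ℕ} :
    l ∈ lines U ↔ (l = cycL ∨ l ∈ sylL) ∨ ∃ D ∈ arcL U, ∃ d ∈ D, l = lineOf D d := by
  simp [lines, eq_comm, or_assoc]

theorem mem_bases {U : AffineName} {l : List ℕ} :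
    l ∈ bases U ↔ (l = cycL ∨ l ∈ sylL) ∨ l ∈ arcL U := by
  simp [bases, or_assoc]

theorem length_lines {U : AffineName} {l : List ℕ} (hl : l ∈ lines U) :
    l ∈ sylL ∧ l.length = 8 ∨ l ∉ sylL ∧ l.length = 9 := by
  have h : l ∈ sylL ∨ l.length = 9 := by
    rcases mem_lines.1 hl with (rfl | h) | ⟨D, hD, d, -, rfl⟩
    · exact Or.inr cycL_length
    · exact Or.inl h
    · rw [lineOf, List.length_map]; exact Or.inr (arcL_length U D hD)
  rcases h with h | h
  · exact Or.inl ⟨h, sylL_length l h⟩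
  · refine Or.inr ⟨fun h' => ?_, h⟩
    rw [sylL_length l h'] at h; omega

theorem exists_mem_ne {U : AffineName} {l : List ℕ} (hl : l ∈ lines U) : ∃ x ∈ l, x ≠ 513 := by
  by_contra! h
  have h1 : l.length ≤ 1 := by
    rw [← List.toFinset_card_of_nodup (lines_spec U l hl).2.2]
    exact (Finset.card_le_card (fun x hx => Finset.mem_singleton.2 (h x (by simpa using hx)))).trans
      (Finset.card_singleton 513).le
  rcases length_lines hl with h2 | h2 <;> omega

theorem lines_nodup (U : AffineName) : (lines U).Nodup := by
  have h := (List.nodup_flatMap.1 (master_nodup U)).2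
  refine List.Pairwise.imp_of_mem (fun {l l'} hl _ hd => ?_) h
  rintro rfl
  obtain ⟨x, hx, h1⟩ := exists_mem_ne hl
  have : x ∈ punct l := mem_punct.2 ⟨hx, h1⟩
  exact hd this this

theorem lines_length (U : AffineName) : (lines U).length = 64 := by
  cases U <;> decide +kernel

end Lines

/-! ### The blocks of the affine unitals -/

section Affine

variable {F : Type*} [Field F] [CharP F 2] {z : F} [hz : IsRoot8 z]

theorem mem_blocks_iff {U : AffineName} {b : Set (SL2 F)} :
    b ∈ blocks z hz.eq U ↔ ∃ l ∈ bases U, ∃ g, b = rightTranslate (lset z l) g := by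
  constructor
  · rintro ((⟨g, rfl⟩ | ⟨T, g, rfl⟩) | ⟨D, hD, g, rfl⟩)
    · exact ⟨cycL, mem_bases.2 (Or.inl (Or.inl rfl)), g, by rw [coe_cyclicC]⟩
    · obtain ⟨l, hl, h⟩ := exists_coe_sylow_eq (z := z) T
      exact ⟨l, mem_bases.2 (Or.inl (Or.inr hl)), g, by rw [h]⟩
    · rw [arcuate_eq] at hD
      obtain ⟨l, hl, rfl⟩ := hD
      exact ⟨l, mem_bases.2 (Or.inr hl), g, rfl⟩
  · rintro ⟨l, hl, g, rfl⟩
    rcases mem_bases.1 hl with (rfl | hl) | hl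
    · exact Or.inl (Or.inl ⟨g, by rw [coe_cyclicC]⟩)
    · obtain ⟨T, hT⟩ := exists_sylow_coe_eq (z := z) hl
      exact Or.inl (Or.inr ⟨T, g, by rw [hT]⟩)
    · exact Or.inr ⟨lset z l, by rw [arcuate_eq]; exact ⟨l, hl, rfl⟩, g, rfl⟩

theorem rightTranslate_mem_blocks {U : AffineName} {b : Set (SL2 F)} (g : SL2 F) :
    rightTranslate b g ∈ blocks z hz.eq U ↔ b ∈ blocks z hz.eq U := by
  refine ⟨fun h => ?_, fun h => rightTranslate_affineBlocks h g⟩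
  have := rightTranslate_affineBlocks h g⁻¹
  rwa [rightTranslate_rightTranslate, mul_inv_cancel, rightTranslate_one] at this

theorem rightTranslate_lset_self {l : List ℕ} (hl : l = cycL ∨ l ∈ sylL) {g : SL2 F}
    (hg : g ∈ lset z l) : rightTranslate (lset z l) g = lset z l := by
  rcases hl with rfl | hl
  · rw [← coe_cyclicC] at hg ⊢
    exact rightTranslate_subgroup _ hg
  · obtain ⟨T, hT⟩ := exists_sylow_coe_eq (z := z) hl
    rw [← hT] at hg ⊢
    exact rightTranslate_subgroup T.toSubgroup hg

theorem inv_mem_lset {l : List ℕ} (hl : l = cycL ∨ l ∈ sylL) {g : SL2 F} (hg : g⁻¹ ∈ lset z l) :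
    g ∈ lset z l := by
  rcases hl with rfl | hl
  · rw [← coe_cyclicC] at hg ⊢
    exact inv_mem_iff.1 hg
  · obtain ⟨T, hT⟩ := exists_sylow_coe_eq (z := z) hl
    rw [← hT] at hg ⊢
    exact inv_mem_iff.1 hg

theorem lset_lineOf {U : AffineName} {D : List ℕ} (hD : D ∈ arcL U) (g : SL2 F) :
    lset z (lineOf D (code z g)) = rightTranslate (lset z D) g⁻¹ := by
  rw [rightTranslate_lset (bases_spec U D (bases_of_mem_arcL hD)).1, code_inv, lineOf]

/-- A coset of a subgroup that contains 1 is the subgroup itself, and $1\in Dg$ forces $g=d^{-1}$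
with $d\in D$. -/
theorem one_mem_block_iff {U : AffineName} {b : Set (SL2 F)} :
    b ∈ blocks z hz.eq U ∧ 1 ∈ b ↔ ∃ l ∈ lines U, b = lset z l := by
  constructor
  · rintro ⟨hb, h1⟩
    obtain ⟨l, hl, g, rfl⟩ := mem_blocks_iff.1 hb
    rw [mem_rightTranslate, one_mul] at h1
    rcases mem_bases.1 hl with hl | hl
    · exact ⟨l, mem_lines.2 (Or.inl hl), rightTranslate_lset_self hl (inv_mem_lset hl h1)⟩
    · refine ⟨_, mem_lines.2 (Or.inr ⟨l, hl, _, h1, rfl⟩), ?_⟩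
      rw [lset_lineOf hl, inv_inv]
  · rintro ⟨l, hl, rfl⟩
    refine ⟨?_, by rw [mem_lset, code_one]; exact (lines_spec U l hl).2.1⟩
    rcases mem_lines.1 hl with hl | ⟨D, hD, d, hd, rfl⟩
    · exact mem_blocks_iff.2 ⟨l, mem_bases.2 (Or.inl hl), 1, (rightTranslate_one _).symm⟩
    · obtain ⟨g, rfl⟩ := exists_code_eq z ((bases_spec U D (bases_of_mem_arcL hD)).1 d hd)
      exact mem_blocks_iff.2 ⟨D, bases_of_mem_arcL hD, g⁻¹, lset_lineOf hD g⟩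

theorem mem_block_iff {U : AffineName} {b : Set (SL2 F)} (y : SL2 F) :
    b ∈ blocks z hz.eq U ∧ y ∈ b ↔ ∃ l ∈ lines U, b = rightTranslate (lset z l) y := by
  have h : b ∈ blocks z hz.eq U ∧ y ∈ b ↔
      rightTranslate b y⁻¹ ∈ blocks z hz.eq U ∧ 1 ∈ rightTranslate b y⁻¹ := by
    rw [rightTranslate_mem_blocks, mem_rightTranslate, inv_inv, one_mul]
  rw [h, one_mem_block_iff]
  refine exists_congr fun l => and_congr_right fun _ => ⟨fun h => ?_, fun h => ?_⟩
  · rw [← h, rightTranslate_rightTranslate, inv_mul_cancel, rightTranslate_one]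
  · rw [h, rightTranslate_rightTranslate, mul_inv_cancel, rightTranslate_one]

theorem code_ne {A : SL2 F} (h : A ≠ 1) : code z A ≠ 513 := fun h' =>
  h (code_injective (z := z) (h'.trans (code_one (z := z)).symm))

/-- Translating $x$ to 1 reduces this to the unique line through 1 and $yx^{-1}$. -/
theorem blocks_joining (U : AffineName) (x y : SL2 F) (hxy : x ≠ y) :
    ∃! b, b ∈ blocks z hz.eq U ∧ x ∈ b ∧ y ∈ b := by
  have h1 : code z (y * x⁻¹) ≠ 513 := code_ne fun h => hxy (mul_inv_eq_one.1 h).symm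
  obtain ⟨l, hl, h⟩ := exists_line (U := U) (code_mem_elems (z := z) (y * x⁻¹)) h1
  obtain ⟨hb, hx⟩ := (mem_block_iff (z := z) x).2 ⟨l, hl, rfl⟩
  refine ⟨_, ⟨hb, hx, mem_rightTranslate.2 h⟩, ?_⟩
  rintro b ⟨hb, hx, hy⟩
  obtain ⟨l', hl', rfl⟩ := (mem_block_iff x).1 ⟨hb, hx⟩
  rw [lines_disjoint hl hl' h (mem_rightTranslate.1 hy) h1]

theorem lset_injective {l l' : List ℕ} (hl : ∀ x ∈ l, x ∈ elems) {x : ℕ} (hx : x ∈ l)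
    (h : lset z l = lset z l') : x ∈ l' := by
  obtain ⟨A, rfl⟩ := exists_code_eq z (hl x hx)
  rw [← mem_lset, ← h]; exact hx

theorem lset_injOn_lines {U : AffineName} {l l' : List ℕ} (hl : l ∈ lines U) (hl' : l' ∈ lines U)
    (h : lset z l = lset z l') : l = l' := by
  obtain ⟨x, hx, h1⟩ := exists_mem_ne hl
  exact lines_disjoint hl hl' hx (lset_injective (lines_spec U l hl).1 hx h) h1

/-- Counting the blocks through a point with a given property. -/
theorem ncard_blocks_through (U : AffineName) (y : SL2 F) (p : Set (SL2 F) → Prop)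
    (q : List ℕ → Bool) (h : ∀ l ∈ lines U, p (rightTranslate (lset z l) y) ↔ q l = true) :
    {b | b ∈ blocks z hz.eq U ∧ y ∈ b ∧ p b}.ncard = (lines U).countP q := by
  have himage : {b | b ∈ blocks z hz.eq U ∧ y ∈ b ∧ p b} =
      (fun l => rightTranslate (lset z l) y) '' (((lines U).filter q).toFinset : Set (List ℕ)) := by
    ext b
    simp only [Set.mem_ofPred_eq, ← and_assoc, mem_block_iff, Set.mem_image, List.coe_toFinset,
      List.mem_filter]
    constructor
    · rintro ⟨⟨l, hl, rfl⟩, hp⟩; exact ⟨l, ⟨hl, (h l hl).1 hp⟩, rfl⟩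
    · rintro ⟨l, ⟨hl, hp⟩, rfl⟩; exact ⟨⟨l, hl, rfl⟩, (h l hl).2 hp⟩
  rw [himage, Set.InjOn.ncard_image, Set.ncard_coe_finset, List.toFinset_card_of_nodup,
    List.countP_eq_length_filter]
  · exact (lines_nodup U).filter _
  · intro l hl l' hl' h
    simp only [List.coe_toFinset, List.mem_filter, Set.mem_ofPred_eq] at hl hl'
    exact lset_injOn_lines hl.1 hl'.1 (rightTranslate_injective y h)

theorem ncard_lset_lines {U : AffineName} {l : List ℕ} (hl : l ∈ lines U) :
    (lset z l).ncard = l.length := ncard_lset (lines_spec U l hl).1 (lines_spec U l hl).2.2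

theorem ncard_lset_bases {U : AffineName} {l : List ℕ} (hl : l ∈ bases U) :
    (lset z l).ncard = l.length := ncard_lset (bases_spec U l hl).1 (bases_spec U l hl).2.2

theorem length_bases {U : AffineName} {l : List ℕ} (hl : l ∈ bases U) :
    l ∈ sylL ∧ l.length = 8 ∨ l ∉ sylL ∧ l.length = 9 := by
  have h : l ∈ sylL ∨ l.length = 9 := by
    rcases mem_bases.1 hl with (rfl | h) | h
    · exact Or.inr cycL_length
    · exact Or.inl h
    · exact Or.inr (arcL_length U l h)
  rcases h with h | h
  · exact Or.inl ⟨h, sylL_length l h⟩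
  · refine Or.inr ⟨fun h' => ?_, h⟩
    rw [sylL_length l h'] at h; omega

theorem shortBlocks_eq (U : AffineName) : shortBlocks 8 (blocks z hz.eq U) =
    {b | ∃ (T : Sylow 2 (SL2 F)) (g : SL2 F), b = rightTranslate (T : Set (SL2 F)) g} := by
  ext b
  constructor
  · rintro ⟨hb, h8⟩
    obtain ⟨l, hl, g, rfl⟩ := mem_blocks_iff.1 hb
    rw [ncard_rightTranslate, ncard_lset_bases hl] at h8
    rcases length_bases hl with ⟨h, -⟩ | ⟨-, h⟩
    · obtain ⟨T, hT⟩ := exists_sylow_coe_eq (z := z) h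
      exact ⟨T, g, by rw [hT]⟩
    · omega
  · rintro ⟨T, g, rfl⟩
    refine ⟨Or.inl (Or.inr ⟨T, g, rfl⟩), ?_⟩
    obtain ⟨l, hl, h⟩ := exists_coe_sylow_eq (z := z) T
    rw [ncard_rightTranslate, h, ncard_sylL hl]

theorem ncard_sylow (z : F) [IsRoot8 z] (T : Sylow 2 (SL2 F)) : (T : Set (SL2 F)).ncard = 8 := by
  obtain ⟨l, hl, h⟩ := exists_coe_sylow_eq (z := z) T
  rw [h, ncard_sylL hl]

theorem sylL_nodup : sylL.Nodup :=
  (List.nodup_cons.1 (List.nodup_append.1 (lines_nodup .WU)).1).2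

theorem mem_lines_of_mem_sylL {U : AffineName} {l : List ℕ} (hl : l ∈ sylL) : l ∈ lines U :=
  mem_lines.2 (Or.inl (Or.inr hl))

theorem card_sylow (z : F) [IsRoot8 z] : Nat.card (Sylow 2 (SL2 F)) = 9 := by
  have h : Set.range (fun T : Sylow 2 (SL2 F) => (T : Set (SL2 F))) =
      lset z '' (sylL.toFinset : Set (List ℕ)) := by
    ext s
    simp only [Set.mem_range, Set.mem_image, List.coe_toFinset, Set.mem_ofPred_eq]
    constructor
    · rintro ⟨T, rfl⟩
      obtain ⟨l, hl, h⟩ := exists_coe_sylow_eq (z := z) T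
      exact ⟨l, hl, h.symm⟩
    · rintro ⟨l, hl, rfl⟩
      exact exists_sylow_coe_eq hl
  rw [← Nat.card_range_of_injective
    (f := fun T : Sylow 2 (SL2 F) => (T : Set (SL2 F))) SetLike.coe_injective, h,
    Nat.card_coe_set_eq, Set.InjOn.ncard_image, Set.ncard_coe_finset,
    List.toFinset_card_of_nodup sylL_nodup]
  · rfl
  · intro l hl l' hl' h
    simp only [List.coe_toFinset, Set.mem_ofPred_eq] at hl hl'
    exact lset_injOn_lines (U := .WU) (mem_lines_of_mem_sylL hl) (mem_lines_of_mem_sylL hl') h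

end Affine

/-! ### The affine unitals and their parallelisms -/

section Existence

variable {F : Type*} [Field F] [CharP F 2] {z : F} [hz : IsRoot8 z]

theorem cycL_notMem_sylL : cycL ∉ sylL := fun h => by
  have := sylL_length _ h
  rw [cycL_length] at this
  omega

theorem lineOf_ne {U : AffineName} {D : List ℕ} (hD : D ∈ arcL U) {d : ℕ} (hd : d ∈ D) :
    lineOf D d ≠ cycL ∧ lineOf D d ∉ sylL := by
  have h := (List.nodup_append.1 (lines_nodup U)).2.2
  have hm : lineOf D d ∈ (arcL U).flatMap fun D => D.map (lineOf D) :=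
    List.mem_flatMap.2 ⟨D, hD, List.mem_map.2 ⟨d, hd, rfl⟩⟩
  exact ⟨fun h' => h _ List.mem_cons_self _ hm h'.symm,
    fun h' => h _ (List.mem_cons_of_mem _ h') _ hm rfl⟩

theorem lineOf_injective {U : AffineName} {D D' : List ℕ} (hD : D ∈ arcL U) (hD' : D' ∈ arcL U)
    {d d' : ℕ} (hd : d ∈ D) (hd' : d' ∈ D') (h : lineOf D d = lineOf D' d') :
    D = D' ∧ d = d' := by
  have hn := List.nodup_flatMap.1 (List.nodup_append.1 (lines_nodup U)).2.1
  have hs : Std.Symm (Function.onFun List.Disjoint fun D : List ℕ => D.map (lineOf D)) :=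
    ⟨fun _ _ h => h.symm⟩
  have hDD : D = D' := by
    by_contra hne
    exact hn.2.forall hD hD' hne (List.mem_map.2 ⟨d, hd, rfl⟩) (List.mem_map.2 ⟨d', hd', h.symm⟩)
  subst hDD
  exact ⟨rfl, List.inj_on_of_nodup_map (hn.1 D hD) hd hd' h⟩

theorem lineOf_mem {U : AffineName} {D : List ℕ} (hD : D ∈ arcL U) {d : ℕ} (hd : d ∈ D) :
    lineOf D d ∈ lines U := mem_lines.2 (Or.inr ⟨D, hD, d, hd, rfl⟩)

/-- $D^*$ is the union of the punctured lines $Dd^{-1}$, so (P) becomes a statement about lines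
through 1. -/
theorem mem_star_iff {D : List ℕ} (hD : ∀ x ∈ D, x ∈ elems) {u : SL2 F} :
    u ∈ star (lset z D) ↔ u ≠ 1 ∧ ∃ d ∈ D, code z u ∈ lineOf D d := by
  constructor
  · rintro ⟨⟨x, y⟩, ⟨hx, hy, hxy⟩, rfl⟩
    refine ⟨fun h => hxy (mul_inv_eq_one.1 h), code z y, hy, List.mem_map.2 ⟨code z x, hx, ?_⟩⟩
    rw [code_mul, code_inv]
  · rintro ⟨h1, d, hd, h⟩
    obtain ⟨x, hx, h⟩ := List.mem_map.1 h
    obtain ⟨y, rfl⟩ := exists_code_eq z (hD d hd)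
    obtain ⟨x, rfl⟩ := exists_code_eq z (hD x hx)
    rw [← code_inv, ← code_mul] at h
    have h' := code_injective h
    exact ⟨⟨x, y⟩, ⟨hx, hd, fun hxy => h1 (h'.symm.trans (mul_inv_eq_one.2 hxy))⟩, h'⟩

theorem isAffineSL2Unital (U : AffineName) :
    IsAffineSL2Unital 2 (cyclicC z hz.eq) (arcuate z hz.eq U) := by
  have hE : ∀ D ∈ arcL U, ∀ x ∈ D, x ∈ elems := fun D hD =>
    (bases_spec U D (bases_of_mem_arcL hD)).1
  have hcyc : cycL ∈ bases U := mem_bases.2 (Or.inl (Or.inl rfl))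
  have hcycl : cycL ∈ lines U := mem_lines.2 (Or.inl (Or.inl rfl))
  have hpiece : ∀ i, ∀ u ∈ piece 2 (cyclicC z hz.eq) (arcuate z hz.eq U) i, u ≠ 1 := by
    rintro (i | T | D) u hu
    · exact hu.2
    · exact hu.2
    · obtain ⟨⟨x, y⟩, ⟨-, -, hxy⟩, rfl⟩ := hu
      exact fun h => hxy (mul_inv_eq_one.1 h)
  refine ⟨?_, ?_, ?_, ?_, ?_, ?_, ?_⟩
  · rw [hz.card]
    change ((cyclicC z hz.eq : Set (SL2 F))).ncard = 9
    rw [coe_cyclicC, ncard_lset_bases hcyc, cycL_length]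
  · intro D hD
    rw [arcuate_eq] at hD
    obtain ⟨l, hl, rfl⟩ := hD
    rw [mem_lset, code_one]
    exact (bases_spec U l (bases_of_mem_arcL hl)).2.1
  · intro D hD
    rw [arcuate_eq] at hD
    obtain ⟨l, hl, rfl⟩ := hD
    rw [ncard_lset_bases (bases_of_mem_arcL hl), hz.card, arcL_length U l hl]
  · intro D hD
    rw [arcuate_eq] at hD
    obtain ⟨l, hl, rfl⟩ := hD
    rintro ⟨x, y⟩ ⟨hx, hy, hxy⟩ ⟨x', y'⟩ ⟨hx', hy', hxy'⟩ h
    simp only at hx hy hxy hx' hy' hxy' h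
    -- A common quotient $xy^{-1}=x'y'^{-1}\ne1$ lies on both lines $Dy^{-1}$ and $Dy'^{-1}$; so
    -- these coincide, and a line determines the $d$ that produced it.
    have h1 : code z (x * y⁻¹) ∈ lineOf l (code z y) :=
      List.mem_map.2 ⟨_, hx, by rw [code_mul, code_inv]⟩
    have h2 : code z (x * y⁻¹) ∈ lineOf l (code z y') := by
      rw [h]; exact List.mem_map.2 ⟨_, hx', by rw [code_mul, code_inv]⟩
    have h3 := lines_disjoint (lineOf_mem hl hy) (lineOf_mem hl hy') h1 h2
      (code_ne fun h => hxy (mul_inv_eq_one.1 h))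
    have hyy := code_injective (lineOf_injective hl hl hy hy' h3).2
    subst hyy
    rw [mul_left_injective _ h]
  · have hne : ∀ l ∈ lines U, ∃ u : SL2 F, u ≠ 1 ∧ code z u ∈ l := by
      intro l hl
      obtain ⟨x, hx, h1⟩ := exists_mem_ne hl
      obtain ⟨u, rfl⟩ := exists_code_eq z ((lines_spec U l hl).1 x hx)
      exact ⟨u, fun h => h1 (by rw [h, code_one]), hx⟩
    rintro (i | T | ⟨D, hD⟩)
    · obtain ⟨u, h1, hu⟩ := hne _ hcycl
      refine ⟨u, ?_, h1⟩
      rw [coe_cyclicC]; exact hu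
    · obtain ⟨l, hl, h⟩ := exists_coe_sylow_eq (z := z) T
      obtain ⟨u, h1, hu⟩ := hne _ (mem_lines_of_mem_sylL hl)
      refine ⟨u, ?_, h1⟩
      rw [h]; exact hu
    · have hD' := hD
      rw [arcuate_eq] at hD'
      obtain ⟨l, hl, rfl⟩ := hD'
      have h513 := (bases_spec U l (bases_of_mem_arcL hl)).2.1
      obtain ⟨u, h1, hu⟩ := hne _ (lineOf_mem hl h513)
      exact ⟨u, (mem_star_iff (hE l hl)).2 ⟨h1, _, h513, hu⟩⟩
  -- The line through 1 and $u$ determines the piece containing $u$, so distinct pieces cannot share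
  -- an element.
  · have key : ∀ i, ∀ u ∈ piece 2 (cyclicC z hz.eq) (arcuate z hz.eq U) i,
        ∃ l ∈ lines U, code z u ∈ l ∧ ((i = .inl () ∧ l = cycL) ∨
          (∃ T : Sylow 2 (SL2 F), i = .inr (.inl T) ∧ l ∈ sylL ∧ (T : Set (SL2 F)) = lset z l) ∨
          ∃ D, i = .inr (.inr D) ∧ ∃ L ∈ arcL U, D.1 = lset z L ∧ ∃ d ∈ L, l = lineOf L d) := by
      rintro (i | T | ⟨D, hD⟩) u hu
      · refine ⟨cycL, hcycl, ?_, Or.inl ⟨rfl, rfl⟩⟩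
        have := hu.1
        rwa [coe_cyclicC] at this
      · obtain ⟨l, hl, h⟩ := exists_coe_sylow_eq (z := z) T
        refine ⟨l, mem_lines_of_mem_sylL hl, ?_, Or.inr (Or.inl ⟨T, rfl, hl, h⟩)⟩
        have := hu.1
        rwa [h] at this
      · have hD' := hD
        rw [arcuate_eq] at hD'
        obtain ⟨L, hL, rfl⟩ := hD'
        obtain ⟨-, d, hd, h⟩ := (mem_star_iff (hE L hL)).1 hu
        exact ⟨_, lineOf_mem hL hd, h, Or.inr (Or.inr ⟨_, rfl, L, hL, rfl, d, hd, rfl⟩)⟩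
    intro i j hij
    rw [Set.disjoint_left]
    intro u hi hj
    obtain ⟨l, hl, hul, h⟩ := key i u hi
    obtain ⟨l', hl', hul', h'⟩ := key j u hj
    obtain rfl := lines_disjoint hl hl' hul hul' (code_ne (hpiece i u hi))
    apply hij
    rcases h with ⟨rfl, rfl⟩ | ⟨T, rfl, hs, hT⟩ | ⟨D, rfl, L, hL, hD, d, hd, rfl⟩
    · rcases h' with ⟨rfl, -⟩ | ⟨T, rfl, hs, hT⟩ | ⟨D, rfl, L, hL, hD, d, hd, h⟩
      · rfl
      · exact absurd hs cycL_notMem_sylL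
      · exact absurd h.symm (lineOf_ne hL hd).1
    · rcases h' with ⟨rfl, rfl⟩ | ⟨T', rfl, -, hT'⟩ | ⟨D, rfl, L, hL, hD, d, hd, rfl⟩
      · exact absurd hs cycL_notMem_sylL
      · rw [SetLike.coe_injective (hT.trans hT'.symm)]
      · exact absurd hs (lineOf_ne hL hd).2
    · rcases h' with ⟨rfl, h⟩ | ⟨T', rfl, h, hT'⟩ | ⟨D', rfl, L', hL', hD', d', hd', h⟩
      · exact absurd h (lineOf_ne hL hd).1
      · exact absurd h (lineOf_ne hL hd).2
      · rw [Subtype.ext (hD.trans ((congrArg _ (lineOf_injective hL hL' hd hd' h).1).trans hD'.symm))]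
  · ext u
    rw [Set.mem_iUnion, Set.mem_compl_singleton_iff]
    constructor
    · rintro ⟨i, hi⟩; exact hpiece i u hi
    · intro h1
      obtain ⟨l, hl, hu⟩ := exists_line (U := U) (code_mem_elems (z := z) u) (code_ne h1)
      rcases mem_lines.1 hl with (rfl | hl) | ⟨D, hD, d, hd, rfl⟩
      · refine ⟨.inl (), ?_, h1⟩
        rw [coe_cyclicC]; exact hu
      · obtain ⟨T, hT⟩ := exists_sylow_coe_eq (z := z) hl
        refine ⟨.inr (.inl T), ?_, h1⟩
        rw [hT]; exact hu
      · refine ⟨.inr (.inr ⟨lset z D, ?_⟩), (mem_star_iff (hE D hD)).2 ⟨h1, d, hd, hu⟩⟩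
        rw [arcuate_eq]; exact ⟨D, hD, rfl⟩

/-! ### The flat and the natural parallelism -/

section Parallelism

theorem rightTranslate_eq_leftTranslate {G : Type*} [Group G] (T : Sylow 2 G) (g : G) :
    rightTranslate (T : Set G) g = leftTranslate g ((g⁻¹ • T : Sylow 2 G) : Set G) := by
  ext x
  rw [mem_rightTranslate, mem_leftTranslate, Sylow.coe_smul, Set.mem_smul_set_iff_inv_smul_mem]
  simp [MulAut.smul_def, mul_assoc]

theorem leftTranslate_eq_rightTranslate {G : Type*} [Group G] (T : Sylow 2 G) (g : G) :
    leftTranslate g (T : Set G) = rightTranslate ((g • T : Sylow 2 G) : Set G) g := by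
  rw [rightTranslate_eq_leftTranslate, inv_smul_smul]

/-- A coset determines its subgroup; this makes the classes of the parallelism disjoint. -/
theorem eq_of_rightTranslate_eq {G : Type*} [Group G] {T T' : Sylow 2 G} {g g' : G}
    (h : rightTranslate (T : Set G) g = rightTranslate (T' : Set G) g') : T = T' := by
  have h1 : g * g'⁻¹ ∈ T' := by
    have : g ∈ rightTranslate (T : Set G) g := mem_rightTranslate.2 (by simp [one_mem])
    rw [h] at this
    exact mem_rightTranslate.1 this
  have h2 : (T : Set G) = rightTranslate (T' : Set G) (g' * g⁻¹) := by
    rw [← rightTranslate_rightTranslate, ← h, rightTranslate_rightTranslate, mul_inv_cancel,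
      rightTranslate_one]
  have h3 : g' * g⁻¹ ∈ T'.toSubgroup := by
    have := T'.toSubgroup.inv_mem h1
    simpa using this
  exact SetLike.coe_injective (h2.trans (rightTranslate_subgroup T'.toSubgroup h3))

theorem eq_of_leftTranslate_eq {G : Type*} [Group G] {T T' : Sylow 2 G} {g g' : G}
    (h : leftTranslate g (T : Set G) = leftTranslate g' (T' : Set G)) : T = T' := by
  have h1 : g'⁻¹ * g ∈ T' := by
    have : g ∈ leftTranslate g (T : Set G) := mem_leftTranslate.2 (by simp [one_mem])
    rw [h] at this
    exact mem_leftTranslate.1 this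
  refine SetLike.coe_injective (Set.ext fun x => ?_)
  have h2 : x ∈ (T : Set G) ↔ g * x ∈ leftTranslate g (T : Set G) := by
    rw [mem_leftTranslate, inv_mul_cancel_left]
  rw [h2, h, mem_leftTranslate, ← mul_assoc]
  exact T'.toSubgroup.mul_mem_cancel_left h1

/-- If each of nine families is a partition of the group into sets of size eight, the families form
a parallelism. -/
theorem isParallelism_of {B : Set (Set (SL2 F))} (z : F) [IsRoot8 z]
    (f : Sylow 2 (SL2 F) → SL2 F → Set (SL2 F)) (hmem : ∀ T x, x ∈ f T x)
    (heq : ∀ T x y, x ∈ f T y → f T x = f T y) (h8 : ∀ T x, (f T x).ncard = 8)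
    (hinj : ∀ T T' x x', f T x = f T' x' → T = T')
    (hB : shortBlocks 8 B = {b | ∃ T x, b = f T x}) :
    IsParallelism 8 B {c | ∃ T, c = {b | ∃ x, b = f T x}} ∧
      ∀ c ∈ {c | ∃ T, c = {b | ∃ x, b = f T x}}, ∀ x, ∃ b ∈ c, x ∈ b := by
  classical
  have := finite_SL2 z
  refine ⟨⟨?_, ?_, ?_, ?_, ?_⟩, ?_⟩
  · rw [hB]
    ext b
    constructor
    · rintro ⟨_, ⟨T, rfl⟩, x, hx⟩; exact ⟨T, x, hx⟩
    · rintro ⟨T, x, hx⟩; exact ⟨_, ⟨T, rfl⟩, x, hx⟩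
  · rintro _ ⟨T, rfl⟩ _ ⟨T', rfl⟩ hne
    refine Set.disjoint_left.2 ?_
    rintro _ ⟨x, rfl⟩ ⟨x', h⟩
    obtain rfl := hinj _ _ _ _ h
    exact hne rfl
  · have h : {c | ∃ T, c = {b | ∃ x, b = f T x}} = Set.range fun T => {b | ∃ x, b = f T x} := by
      ext c; exact exists_congr fun T => eq_comm
    rw [h, ← Nat.card_coe_set_eq, Nat.card_range_of_injective, card_sylow z]
    intro T T' h
    have h1 : f T 1 ∈ {b | ∃ x, b = f T' x} := h.subset ⟨1, rfl⟩
    obtain ⟨x, hx⟩ := h1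
    exact hinj _ _ _ _ hx
  · rintro _ ⟨T, rfl⟩
    have := Fintype.ofFinite (SL2 F)
    have h : {b | ∃ x, b = f T x} = ((Finset.univ.image (f T) : Finset (Set (SL2 F))) :
        Set (Set (SL2 F))) := by
      ext b; simp [eq_comm]
    -- The fibres of `f T` are the blocks of the class, each with 8 points, so the class has
    -- $504/8=63=8^2-1$ blocks.
    have h1 := Finset.card_eq_sum_card_image (f T) Finset.univ
    rw [Finset.card_univ, ← Nat.card_eq_fintype_card, card_SL2 z,
      Finset.sum_congr rfl (g := fun _ => 8), Finset.sum_const, smul_eq_mul] at h1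
    · rw [h, Set.ncard_coe_finset]; omega
    · intro b hb
      obtain ⟨x, -, rfl⟩ := Finset.mem_image.1 hb
      rw [← h8 T x, ← Set.ncard_coe_finset]
      congr 1
      ext y
      simp only [Finset.coe_filter, Finset.mem_univ, true_and, Set.mem_ofPred_eq]
      exact ⟨fun h => h ▸ hmem T y, heq T y x⟩
  · rintro _ ⟨T, rfl⟩ _ ⟨x, rfl⟩ _ ⟨y, rfl⟩ hne
    refine Set.disjoint_left.2 fun w hx hy => hne ?_
    rw [← heq T w x hx, heq T w y hy]
  · rintro _ ⟨T, rfl⟩ x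
    exact ⟨f T x, ⟨x, rfl⟩, hmem T x⟩

theorem isParallelism (U : AffineName) (π : ParallelismName) :
    IsParallelism 8 (blocks z hz.eq U) (parallelism F π) ∧
      ∀ c ∈ parallelism F π, ∀ x, ∃ b ∈ c, x ∈ b := by
  cases π
  · refine isParallelism_of z (fun T x => rightTranslate (T : Set (SL2 F)) x) ?_ ?_ ?_ ?_
      (shortBlocks_eq U)
    · intro T x; exact mem_rightTranslate.2 (by simp [one_mem])
    · intro T x y h
      have h1 := rightTranslate_subgroup T.toSubgroup (mem_rightTranslate.1 h)
      have h2 := rightTranslate_rightTranslate (T : Set (SL2 F)) (x * y⁻¹) y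
      rw [inv_mul_cancel_right] at h2
      exact h2.symm.trans (congrArg (rightTranslate · y) h1)
    · intro T x; rw [ncard_rightTranslate, ncard_sylow z]
    · intro T T' x x' h; exact eq_of_rightTranslate_eq h
  · refine isParallelism_of z (fun T x => leftTranslate x (T : Set (SL2 F))) ?_ ?_ ?_ ?_ ?_
    · intro T x; exact mem_leftTranslate.2 (by simp [one_mem])
    · intro T x y h
      ext w
      rw [mem_leftTranslate] at h
      rw [mem_leftTranslate, mem_leftTranslate]
      have h1 := T.toSubgroup.mul_mem_cancel_left h (y := x⁻¹ * w)
      rw [← mul_assoc, mul_assoc y⁻¹, mul_inv_cancel, mul_one] at h1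
      exact h1.symm
    · intro T x; rw [ncard_leftTranslate, ncard_sylow z]
    · intro T T' x x' h; exact eq_of_leftTranslate_eq h
    · rw [shortBlocks_eq]
      ext b
      constructor
      · rintro ⟨T, g, rfl⟩; exact ⟨_, g, rightTranslate_eq_leftTranslate T g⟩
      · rintro ⟨T, g, rfl⟩; exact ⟨_, g, leftTranslate_eq_rightTranslate T g⟩

end Parallelism

theorem isAffineUnital (U : AffineName) : IsAffineUnital 8 (blocks z hz.eq U) := by
  refine ⟨by norm_num, by rw [card_SL2 z]; norm_num, ?_, ?_, blocks_joining U,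
    ⟨_, (isParallelism U .flat).1⟩⟩
  · intro b hb
    obtain ⟨l, hl, g, rfl⟩ := mem_blocks_iff.1 hb
    rw [ncard_rightTranslate, ncard_lset_bases hl]
    rcases length_bases hl with h | h <;> omega
  · intro x
    have h := ncard_blocks_through (z := z) U x (fun _ => True) (fun _ => true) (by simp)
    simpa [lines_length] using h

theorem isUnital (U : AffineName) (π : ParallelismName) :
    IsUnital 8 (closureBlocks (blocks z hz.eq U) (parallelism F π)) :=
  isUnital_closure (isAffineUnital U) (isParallelism (z := z) U π).1 (isParallelism (z := z) U π).2

end Existence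

/-! ### The block at infinity -/

/-! ### Maps $x\mapsto\theta(x)k$ and the two parallelisms -/

section Symmetries

variable {G : Type*} [Group G]

theorem coe_mulAut_smul_sylow {p : ℕ} (θ : MulAut G) (T : Sylow p G) :
    ((θ • T : Sylow p G) : Set G) = θ '' (T : Set G) := rfl

theorem coe_smul_sylow {p : ℕ} (g : G) (T : Sylow p G) :
    ((g • T : Sylow p G) : Set G) = (fun x => g * x * g⁻¹) '' (T : Set G) := rfl

theorem image_rightTranslate {θ : MulAut G} {k : G} {σ : G → G} (hσ : ∀ x, σ x = θ x * k)
    (D : Set G) (g : G) : σ '' rightTranslate D g = rightTranslate (θ '' D) (θ g * k) := by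
  rw [rightTranslate, rightTranslate, Set.image_image, Set.image_image]
  refine Set.image_congr fun x _ => ?_
  rw [hσ, map_mul, mul_assoc]

/-- $\theta(gT)k=\theta(g)k\cdot k^{-1}\theta(T)k$: for left cosets the factor $k$ also conjugates
the subgroup. -/
theorem image_leftTranslate {θ : MulAut G} {k : G} {σ : G → G} (hσ : ∀ x, σ x = θ x * k)
    (T : Sylow 2 G) (g : G) : σ '' leftTranslate g (T : Set G) =
      leftTranslate (θ g * k) ((k⁻¹ • θ • T : Sylow 2 G) : Set G) := by
  rw [leftTranslate, leftTranslate, coe_smul_sylow, coe_mulAut_smul_sylow, Set.image_image,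
    Set.image_image, Set.image_image]
  refine Set.image_congr fun x _ => ?_
  rw [hσ, map_mul]
  group

theorem image_class_flat {θ : MulAut G} {k : G} {σ : G → G} (hσ : ∀ x, σ x = θ x * k)
    (T : Sylow 2 G) : Set.image σ '' {b | ∃ g, b = rightTranslate (T : Set G) g} =
      {b | ∃ g, b = rightTranslate ((θ • T : Sylow 2 G) : Set G) g} := by
  ext b
  constructor
  · rintro ⟨_, ⟨g, rfl⟩, rfl⟩
    exact ⟨_, image_rightTranslate hσ _ g⟩
  · rintro ⟨g, rfl⟩
    refine ⟨_, ⟨θ.symm (g * k⁻¹), rfl⟩, ?_⟩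
    rw [image_rightTranslate hσ, MulEquiv.apply_symm_apply, inv_mul_cancel_right]
    rfl

theorem image_class_natural {θ : MulAut G} {k : G} {σ : G → G} (hσ : ∀ x, σ x = θ x * k)
    (T : Sylow 2 G) : Set.image σ '' {b | ∃ g, b = leftTranslate g (T : Set G)} =
      {b | ∃ g, b = leftTranslate g ((k⁻¹ • θ • T : Sylow 2 G) : Set G)} := by
  ext b
  constructor
  · rintro ⟨_, ⟨g, rfl⟩, rfl⟩
    exact ⟨_, image_leftTranslate hσ _ g⟩
  · rintro ⟨g, rfl⟩
    refine ⟨_, ⟨θ.symm (g * k⁻¹), rfl⟩, ?_⟩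
    rw [image_leftTranslate hσ, MulEquiv.apply_symm_apply, inv_mul_cancel_right]

/-- Serves twice: for the translations, and for all affine automorphisms once they are known to have
this form. -/
theorem image_class_mem {F : Type*} [Field F] {θ : MulAut (SL2 F)} {k : SL2 F}
    {σ : SL2 F → SL2 F} (hσ : ∀ x, σ x = θ x * k) (π : ParallelismName) :
    ∀ c ∈ parallelism F π, Set.image σ '' c ∈ parallelism F π := by
  cases π
  · rintro _ ⟨T, rfl⟩
    exact ⟨_, image_class_flat hσ T⟩
  · rintro _ ⟨T, rfl⟩
    exact ⟨_, image_class_natural hσ T⟩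

end Symmetries

/-! ### Twins of the block at infinity -/

section Infinity

variable {F : Type*} [Field F] [CharP F 2] {z : F} [hz : IsRoot8 z]

theorem mulRight_mem_autGroup (U : AffineName) (g : SL2 F) :
    Equiv.mulRight g ∈ autGroup (blocks z hz.eq U) :=
  fun _ => rightTranslate_mem_blocks g

theorem exists_translation (z : F) [hz : IsRoot8 z] (U : AffineName) (π : ParallelismName)
    (g : SL2 F) :
    ∃ τ ∈ autGroup (closureBlocks (blocks z hz.eq U) (parallelism F π)),
      (∀ x, τ (Sum.inl x) = Sum.inl (x * g)) ∧
      ∀ b, τ '' extendBlock _ b = extendBlock _ (rightTranslate b g) := by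
  have := finite_SL2 z
  obtain ⟨τ, hτ, h1, h2, -⟩ := exists_extension (mulRight_mem_autGroup (z := z) U g)
    (image_class_mem (θ := 1) (k := g) (fun x => rfl) π)
  exact ⟨τ, hτ, h1, h2⟩

/-- Conjugation by $f$ interchanges the diagonal entries of the symmetric matrix $g$, which inverts
$g$ in characteristic 2. So $\langle C,f\rangle$ is dihedral and $Cf$ consists of involutions. -/
theorem flip_coset_trace : ∀ x ∈ cycL, ∃ l ∈ sylL, cmul x (mk 0 1 1 0) ∈ l := by
  decide +kernel

/-- The block at infinity has twins: `C f` consists of involutions. -/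
theorem hasTwins_blockAtInfinity (U : AffineName) (π : ParallelismName) :
    HasTwins (closureBlocks (blocks z hz.eq U) (parallelism F π))
      (blockAtInfinity (parallelism F π)) := by
  rintro (y | c) hy
  · have hcyc : cycL ∈ bases U := mem_bases.2 (Or.inl (Or.inl rfl))
    have hb : rightTranslate (lset z cycL) (flip F * y) ∈ blocks z hz.eq U :=
      mem_blocks_iff.2 ⟨_, hcyc, _, rfl⟩
    have hkey : ∀ x ∈ rightTranslate (lset z cycL) (flip F * y),
        ∃ l ∈ sylL, x ∈ rightTranslate (lset z l) y := by
      intro x hx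
      rw [mem_rightTranslate, mem_lset] at hx
      obtain ⟨l, hl, h⟩ := flip_coset_trace _ hx
      refine ⟨l, hl, ?_⟩
      rw [← code_flip (z := z), ← code_mul] at h
      rw [mem_rightTranslate, mem_lset]
      convert h using 2
      group
    refine ⟨extendBlock _ _, extendBlock_mem hb, ?_, ?_, ?_⟩
    · intro h
      have hx : flip F * y ∈ rightTranslate (lset z cycL) (flip F * y) := by
        rw [mem_rightTranslate, mul_inv_cancel, mem_lset, code_one]
        exact (bases_spec U _ hcyc).2.1
      have : (Sum.inl (flip F * y) : SL2 F ⊕ parallelism F π) ∈ blockAtInfinity _ := by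
        rw [← h]; simpa using hx
      simp at this
    · rw [inl_mem_extendBlock]
      intro hx
      rw [mem_rightTranslate, mem_lset] at hx
      have h1 : code z (y * (flip F * y)⁻¹) = code z (flip F)⁻¹ := by
        congr 1; group
      rw [h1, code_inv, code_flip] at hx
      revert hx
      decide +kernel
    · have hline : ∀ l ∈ sylL, ∃ b ∈ closureBlocks (blocks z hz.eq U) (parallelism F π),
          (∀ x ∈ rightTranslate (lset z l) y, Sum.inl x ∈ b) ∧
          (b ∩ blockAtInfinity (parallelism F π)).Nonempty := by
        intro l hl
        have hbl : rightTranslate (lset z l) y ∈ blocks z hz.eq U :=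
          mem_blocks_iff.2 ⟨l, mem_bases.2 (Or.inl (Or.inr hl)), y, rfl⟩
        have hs : rightTranslate (lset z l) y ∈ shortBlocks 8 (blocks z hz.eq U) :=
          ⟨hbl, by rw [ncard_rightTranslate, ncard_sylL hl]⟩
        rw [← (isParallelism U π).1.sUnion_eq] at hs
        obtain ⟨c, hc, hbc⟩ := hs
        exact ⟨_, extendBlock_mem hbl, fun x hx => by simpa using hx,
          Sum.inr ⟨c, hc⟩, by simpa using hbc, by simp⟩
      have hy1 : ∀ l ∈ sylL, y ∈ rightTranslate (lset z l) y := fun l hl => by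
        rw [mem_rightTranslate, mul_inv_cancel, mem_lset, code_one]
        exact (sylL_spec hl).2.1
      -- The twin $Cfy$ is long, so its extension has no new points to be checked.
      have h9 : rightTranslate (lset z cycL) (flip F * y) ∉ shortBlocks 8 (blocks z hz.eq U) := by
        rintro ⟨-, h⟩
        rw [ncard_rightTranslate, ncard_lset_bases hcyc, cycL_length] at h
        omega
      rintro (x | c) hx
      · rw [inl_mem_extendBlock] at hx
        obtain ⟨l, hl, hxl⟩ := hkey x hx
        obtain ⟨b, hb, h1, h2⟩ := hline l hl
        exact ⟨b, hb, h1 y (hy1 l hl), h1 x hxl, h2⟩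
      · rw [inr_mem_extendBlock] at hx
        rw [← (isParallelism U π).1.sUnion_eq] at h9
        exact absurd ⟨c.1, c.2, hx⟩ h9
  · simp at hy

end Infinity

/-! ### The computation that rules out twins of all other blocks -/

section Twist

/-- Test for the bit `n` of `m`. -/
def bit (m n : ℕ) : Bool := Nat.beq (Nat.land (Nat.shiftRight m n) 1) 1

theorem bit_eq_testBit (m n : ℕ) : bit m n = m.testBit n := by
  rw [Nat.testBit, bit]
  change Nat.beq ((m >>> n) &&& 1) 1 = (1 &&& (m >>> n) != 0)
  rw [Nat.and_comm, Nat.one_and_eq_mod_two]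
  rcases Nat.mod_two_eq_zero_or_one (m >>> n) with h | h <;> rw [h] <;> rfl

/-- The number with the bits in `l`. -/
def maskOf (l : List ℕ) : ℕ := l.foldr (fun x m => Nat.lor m (Nat.shiftLeft 1 x)) 0

theorem bit_maskOf {l : List ℕ} {n : ℕ} : bit (maskOf l) n = true ↔ n ∈ l := by
  rw [bit_eq_testBit]
  induction l with
  | nil => simp [maskOf]
  | cons a l ih =>
    change (maskOf l ||| (1 <<< a)).testBit n = true ↔ _
    rw [Nat.testBit_or, Nat.one_shiftLeft, Nat.testBit_two_pow, Bool.or_eq_true,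
      decide_eq_true_iff, List.mem_cons, or_comm, eq_comm]
    exact or_congr Iff.rfl ih

/-- Evaluate the number before applying `k`. -/
def withNat (n : ℕ) (k : ℕ → Bool) : Bool := Nat.rec (k 0) (fun m _ => k (m + 1)) n

theorem withNat_eq (n : ℕ) (k : ℕ → Bool) : withNat n k = k n := by cases n <;> rfl

/-- The right translate by `h`. -/
def transL (D : List ℕ) (h : ℕ) : List ℕ := D.map fun x => cmul x h

/-- A set of points containing all points that are joined to `1` by a block that meets the
translate `D h` or (if `D` is a Sylow subgroup) is parallel to it. -/
def allowed (U : AffineName) (D : List ℕ) (h : ℕ) : List ℕ :=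
  ((lines U).filter fun l => l.any (bit (maskOf (transL D h)))).flatten ++
    bif Nat.beq D.length 8 then D ++ D.map (cconj h) else []

/-- For each entry `D` of `bases`, an element `h` such that `D h` is the only block contained in
`allowed D h`. -/
def twists : AffineName → List ℕ
  | .WU => [74, 168, 168, 74] ++ List.replicate 12 72
  | .OU => [74, 72, 72, 73] ++ List.replicate 12 72
  | .PU => [74, 72, 72, 73] ++ List.replicate 12 72

/-- The pairs of an entry `D` of `bases` and the corresponding element `h`. -/
def twisted (U : AffineName) : List (List ℕ × ℕ) := (bases U).zip (twists U)

/-- The position in `table` of the bits for the element `x`. -/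
def slot (x : ℕ) : ℕ := Nat.mul 16 (Nat.mod x 491)

/-- The table of all sets `allowed`: the entries of `twisted` are numbered from `i` on, and the bit
`j` of the entry for `x` is set if `x` is in the set number `j`. -/
def table (U : AffineName) : ℕ → List (List ℕ × ℕ) → List ℕ
  | _, [] => []
  | i, p :: ps => (allowed U p.1 p.2).map (fun x => Nat.add (slot x) i) ++ table U (i + 1) ps

/-- The bits in `acc` of those sets in the table `V` that contain the translate `D y`. -/
def survivors (V y : ℕ) : List ℕ → ℕ → ℕ
  | [], acc => acc
  | d :: D, acc => bif Nat.beq acc 0 then 0 else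
      survivors V y D (Nat.land acc (Nat.shiftRight V (slot (cmul d y))))

/-- Only this direction is needed: a translate contained in an allowed set survives. Distinct
elements may share a slot, which merely adds survivors, so soundness does not require `slot` to be
injective. -/
theorem bit_survivors {V y i : ℕ} {D : List ℕ} {acc : ℕ} (hacc : bit acc i = true)
    (h : ∀ d ∈ D, bit V (slot (cmul d y) + i) = true) : bit (survivors V y D acc) i = true := by
  induction D generalizing acc with
  | nil => exact hacc
  | cons d D ih =>
    have h0 : Nat.beq acc 0 = false := by
      rw [← Bool.not_eq_true, Nat.beq_eq]
      rintro rfl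
      simp [bit_eq_testBit] at hacc
    rw [survivors, h0, cond_false]
    refine ih ?_ fun d hd => h d (List.mem_cons_of_mem _ hd)
    have h1 := h d List.mem_cons_self
    rw [bit_eq_testBit] at h1 hacc ⊢
    change (acc &&& (V >>> slot (cmul d y))).testBit i = true
    rw [Nat.testBit_and, hacc, Nat.testBit_shiftRight, h1]
    rfl

/-- Every translate `D y` with a bit in `r` is contained in the respective translate in the list or
contains `1`. -/
def survivorsCheck (D : List ℕ) (y r : ℕ) : ℕ → List (List ℕ × ℕ) → Bool
  | _, [] => true
  | i, p :: ps => (!bit r i || D.all (fun d => (transL p.1 p.2).any (Nat.beq (cmul d y))) ||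
      D.any fun d => Nat.beq (cmul d y) 513) && survivorsCheck D y r (i + 1) ps

/-- Every block contained in some `allowed D h` is contained in `D h` or contains `1`. -/
def twistCheck (U : AffineName) : Bool :=
  withNat (maskOf (table U 0 (twisted U))) fun V =>
    (bases U).all fun D => elems.all fun y => withNat (survivors V y D 65535) fun r =>
      Nat.beq r 0 || survivorsCheck D y r 0 (twisted U)

-- All $16\cdot504$ pairs of a base block and an element are tested against the sixteen allowed sets
-- simultaneously, one bit for each set.
set_option maxHeartbeats 0 in
theorem twistCheck_eq (U : AffineName) : twistCheck U = true := by
  cases U <;> decide +kernel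

/-- The last clause excludes $[\infty]$ as a twin of $Dh$: some Sylow subgroup neither meets $Dh$
nor is parallel to it, and it is the block joining 1 to the new point of its class. -/
theorem twisted_spec (U : AffineName) : ∀ p ∈ twisted U, p.2 ∈ elems ∧ 513 ∉ transL p.1 p.2 ∧
    ∃ l ∈ sylL, ∃ x ∈ l, x ∉ allowed U p.1 p.2 := by
  have h : ((twisted U).all fun p => isElem p.2 && (!bit (maskOf (transL p.1 p.2)) 513) &&
      sylL.any fun l => l.any fun x => !bit (maskOf (allowed U p.1 p.2)) x) = true := by
    cases U <;> decide +kernel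
  intro p hp
  have := List.all_eq_true.1 h p hp
  simpa only [Bool.and_eq_true, isElem_iff, Bool.not_eq_true', ← Bool.not_eq_true, bit_maskOf,
    List.any_eq_true, and_assoc] using this

theorem twisted_length (U : AffineName) : (bases U).length = (twists U).length := by
  cases U <;> decide +kernel

end Twist

/-! ### Soundness of the computation -/

section Twist

theorem mem_table {U : AffineName} {ps : List (List ℕ × ℕ)} {i j : ℕ} {p : List ℕ × ℕ}
    (hj : ps[j]? = some p) {x : ℕ} (hx : x ∈ allowed U p.1 p.2) :
    slot x + (i + j) ∈ table U i ps := by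
  induction ps generalizing i j with
  | nil => simp at hj
  | cons q ps ih =>
    rw [table, List.mem_append]
    cases j with
    | zero =>
      obtain rfl : q = p := by simpa using hj
      exact Or.inl (List.mem_map.2 ⟨x, hx, rfl⟩)
    | succ j =>
      refine Or.inr ?_
      have := ih (i := i + 1) (j := j) (by simpa using hj)
      rwa [show i + 1 + j = i + (j + 1) by omega] at this

theorem survivorsCheck_spec {D : List ℕ} {y r i j : ℕ} {ps : List (List ℕ × ℕ)}
    {p : List ℕ × ℕ} (h : survivorsCheck D y r i ps = true) (hj : ps[j]? = some p)
    (hr : bit r (i + j) = true) :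
    (∀ d ∈ D, cmul d y ∈ transL p.1 p.2) ∨ ∃ d ∈ D, cmul d y = 513 := by
  induction ps generalizing i j with
  | nil => simp at hj
  | cons q ps ih =>
    rw [survivorsCheck, Bool.and_eq_true] at h
    cases j with
    | zero =>
      obtain rfl : q = p := by simpa using hj
      have h1 := h.1
      rw [add_zero] at hr
      simpa [hr] using h1
    | succ j =>
      exact ih (j := j) h.2 (by simpa using hj)
        (by rwa [show i + 1 + j = i + (j + 1) by omega])

theorem twist_spec {U : AffineName} {p : List ℕ × ℕ} (hp : p ∈ twisted U) {D : List ℕ}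
    (hD : D ∈ bases U) {y : ℕ} (hy : y ∈ elems)
    (h : ∀ d ∈ D, cmul d y ∈ allowed U p.1 p.2) :
    (∀ d ∈ D, cmul d y ∈ transL p.1 p.2) ∨ ∃ d ∈ D, cmul d y = 513 := by
  obtain ⟨j, hj⟩ := List.mem_iff_getElem?.1 hp
  have hlen : (twisted U).length = 16 := by cases U <;> decide +kernel
  have hj16 : j < 16 := by
    rw [← hlen]
    exact (List.getElem?_eq_some_iff.1 hj).1
  have hc := twistCheck_eq U
  rw [twistCheck, withNat_eq] at hc
  have hc := List.all_eq_true.1 (List.all_eq_true.1 hc D hD) y hy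
  rw [withNat_eq] at hc
  -- $65535=2^{16}-1$: all sixteen pairs are candidates at the start.
  have h0 : bit 65535 j = true := by interval_cases j <;> decide +kernel
  have hs := bit_survivors (V := maskOf (table U 0 (twisted U))) (y := y) (D := D) h0
    fun d hd => bit_maskOf.2 (by simpa using mem_table (i := 0) hj (h d hd))
  rw [Bool.or_eq_true, Nat.beq_eq] at hc
  rcases hc with hc | hc
  · rw [hc] at hs
    simp [bit_eq_testBit] at hs
  · exact survivorsCheck_spec hc hj (by rwa [zero_add])

theorem exists_twist {U : AffineName} {D : List ℕ} (hD : D ∈ bases U) :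
    ∃ h, (D, h) ∈ twisted U := by
  obtain ⟨j, hj⟩ := List.mem_iff_getElem?.1 hD
  have hj' : j < (twists U).length := by
    rw [← twisted_length]
    exact (List.getElem?_eq_some_iff.1 hj).1
  refine ⟨(twists U)[j], List.mem_iff_getElem?.2 ⟨j, ?_⟩⟩
  rw [twisted, List.getElem?_zip_eq_some]
  exact ⟨hj, List.getElem?_eq_getElem hj'⟩

end Twist

/-! ### Isomorphisms preserve the block at infinity -/

section Infinity

variable {F : Type*} [Field F] [CharP F 2] {z : F} [hz : IsRoot8 z]

/-- For a Sylow subgroup $D$, the parallel to $Dh=h(h^{-1}Dh)$ through 1 is $D$ with respect to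
$\flat$ and $h^{-1}Dh$ with respect to $\natural$. As `allowed` includes both, one computation
settles both closures. -/
theorem mem_allowed_of_parallel {U : AffineName} {D l : List ℕ} (hD : D ∈ bases U)
    (hl : l ∈ lines U) {π : ParallelismName} {h : SL2 F} {c : Set (Set (SL2 F))}
    (hc : c ∈ parallelism F π) (hlc : lset z l ∈ c) (hDc : rightTranslate (lset z D) h ∈ c)
    {x : SL2 F} (hx : code z x ∈ l) : code z x ∈ allowed U D (code z h) := by
  have hpar := (isParallelism (z := z) U π).1
  have h1 := (hpar.mem_blocks hc hlc).2
  have h2 := (hpar.mem_blocks hc hDc).2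
  rw [ncard_lset_lines hl] at h1
  rw [ncard_rightTranslate, ncard_lset_bases hD] at h2
  have hls : l ∈ sylL := by rcases length_lines hl with h | h <;> [exact h.1; omega]
  have hDs : D ∈ sylL := by rcases length_bases hD with h | h <;> [exact h.1; omega]
  obtain ⟨T, hT⟩ := exists_sylow_coe_eq (z := z) hls
  obtain ⟨T', hT'⟩ := exists_sylow_coe_eq (z := z) hDs
  rw [allowed, h2, List.mem_append]
  refine Or.inr (List.mem_append.2 ?_)
  have hxT : x ∈ (T : Set (SL2 F)) := by rw [hT]; exact hx
  rw [← hT] at hlc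
  rw [← hT'] at hDc
  have hD' : ∀ y ∈ (T' : Set (SL2 F)), code z y ∈ D := fun y hy => by rwa [hT'] at hy
  cases π
  · obtain ⟨T₀, rfl⟩ := hc
    obtain ⟨g, hg⟩ := hlc
    obtain ⟨g', hg'⟩ := hDc
    have e1 := eq_of_rightTranslate_eq ((rightTranslate_one _).trans hg)
    have e2 := eq_of_rightTranslate_eq hg'
    left
    apply hD'
    rwa [e2, ← e1]
  · obtain ⟨T₀, rfl⟩ := hc
    obtain ⟨g, hg⟩ := hlc
    obtain ⟨g', hg'⟩ := hDc
    have e1 : T = T₀ := by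
      rw [← rightTranslate_one (T : Set (SL2 F)), rightTranslate_eq_leftTranslate] at hg
      have := eq_of_leftTranslate_eq hg
      simpa using this
    rw [rightTranslate_eq_leftTranslate] at hg'
    have e2 := eq_of_leftTranslate_eq hg'
    rw [e1, ← e2, coe_smul_sylow] at hxT
    obtain ⟨w, hw, rfl⟩ := hxT
    right
    rw [List.mem_map]
    refine ⟨_, hD' w hw, ?_⟩
    simp only [code_mul, code_inv, cconj, inv_inv]

theorem not_hasTwins_extendBlock (U : AffineName) (π : ParallelismName) :
    ∀ b ∈ blocks z hz.eq U, ¬ HasTwins (closureBlocks (blocks z hz.eq U) (parallelism F π))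
      (extendBlock (parallelism F π) b) := by
  intro b hb htw
  obtain ⟨D, hD, g, rfl⟩ := mem_blocks_iff.1 hb
  obtain ⟨hc, hp⟩ := exists_twist hD
  obtain ⟨h1, h513, s, hs, t, hts, ht⟩ := twisted_spec U _ hp
  obtain ⟨h, rfl⟩ := exists_code_eq z h1
  simp only at h513 ht
  -- Twins are preserved by automorphisms, so $Dg$ may be replaced by $Dh$ and the twin condition
  -- applied to the point 1.
  obtain ⟨τ, hτ, -, hτb⟩ := exists_translation z U π (g⁻¹ * h)
  have htw' := htw.image τ hτ
  rw [hτb, rightTranslate_rightTranslate, mul_inv_cancel_left] at htw'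
  have htr : rightTranslate (lset z D) h = lset z (transL D (code z h)) :=
    rightTranslate_lset (bases_spec U D hD).1 h
  have hDh : rightTranslate (lset z D) h ∈ blocks z hz.eq U := mem_blocks_iff.2 ⟨D, hD, h, rfl⟩
  -- lines through `1` that meet `D h` are allowed
  have hmeet : ∀ l ∈ lines U, (extendBlock (parallelism F π) (lset z l) ∩
      extendBlock (parallelism F π) (rightTranslate (lset z D) h)).Nonempty →
      ∀ x : SL2 F, code z x ∈ l → code z x ∈ allowed U D (code z h) := by
    rintro l hl ⟨q, hq1, hq2⟩ x hx
    rcases q with q | c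
    · rw [inl_mem_extendBlock] at hq1 hq2
      rw [htr] at hq2
      rw [allowed, List.mem_append, List.mem_flatten]
      refine Or.inl ⟨l, List.mem_filter.2 ⟨hl, ?_⟩, hx⟩
      rw [List.any_eq_true]
      exact ⟨_, hq1, bit_maskOf.2 hq2⟩
    · rw [inr_mem_extendBlock] at hq1 hq2
      exact mem_allowed_of_parallel hD hl c.2 hq1 hq2 hx
  obtain ⟨c, hcB, hcne, h1c, hq⟩ := htw' (Sum.inl 1) (by
    rw [inl_mem_extendBlock, htr, mem_lset, code_one]; exact h513)
  rcases eq_or_exists_of_mem_closureBlocks hcB with rfl | ⟨b', hb', rfl⟩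
  · obtain ⟨T, hT⟩ := exists_sylow_coe_eq (z := z) hs
    have hTs : lset z s ∈ shortBlocks 8 (blocks z hz.eq U) := by
      rw [shortBlocks_eq]; exact ⟨T, 1, by rw [rightTranslate_one, hT]⟩
    rw [← (isParallelism U π).1.sUnion_eq] at hTs
    obtain ⟨c, hcπ, hsc⟩ := hTs
    obtain ⟨e, he, h1e, hce, hmt⟩ := hq (Sum.inr ⟨c, hcπ⟩) (by simp)
    rcases eq_or_exists_of_mem_closureBlocks he with rfl | ⟨b, hb, rfl⟩
    · simp at h1e
    · rw [inl_mem_extendBlock] at h1e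
      rw [inr_mem_extendBlock] at hce
      have h1s : (1 : SL2 F) ∈ lset z s := by
        rw [mem_lset, code_one]; exact (sylL_spec hs).2.1
      have hbs : b = lset z s := by
        by_contra hne
        exact Set.disjoint_left.1 ((isParallelism (z := z) U π).1.disjoint_blocks c hcπ hce hsc hne)
          h1e h1s
      rw [hbs] at hmt
      obtain ⟨x, rfl⟩ := exists_code_eq z ((sylL_spec hs).1 t hts)
      exact ht (hmeet s (mem_lines_of_mem_sylL hs) hmt x hts)
  · obtain ⟨D', hD', y, rfl⟩ := mem_blocks_iff.1 hb'
    have hall : ∀ d ∈ D', cmul d (code z y) ∈ allowed U D (code z h) := by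
      intro d hd
      obtain ⟨A, rfl⟩ := exists_code_eq z ((bases_spec U D' hD').1 d hd)
      rw [← code_mul]
      obtain ⟨e, he, h1e, hqe, hmt⟩ := hq (Sum.inl (A * y)) (by
        rw [inl_mem_extendBlock]; exact ⟨A, hd, rfl⟩)
      rcases eq_or_exists_of_mem_closureBlocks he with rfl | ⟨b, hb, rfl⟩
      · simp at h1e
      · rw [inl_mem_extendBlock] at h1e hqe
        obtain ⟨l, hl, rfl⟩ := one_mem_block_iff.1 ⟨hb, h1e⟩
        exact hmeet l hl hmt _ hqe
    -- Containment in $Dh$ gives two common points, hence equality with $Dh$; otherwise the block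
    -- passes through 1. A twin may do neither.
    rcases twist_spec hp hD' (code_mem_elems y) hall with hsub | ⟨d, hd, h1⟩
    · apply hcne
      congr 1
      have hss : rightTranslate (lset z D') y ⊆ rightTranslate (lset z D) h := by
        rintro _ ⟨A, hA, rfl⟩
        rw [htr, mem_lset, code_mul]
        exact hsub _ hA
      have := finite_SL2 z
      have hcard : 1 < (rightTranslate (lset z D') y).ncard := by
        rw [ncard_rightTranslate, ncard_lset_bases hD']
        rcases length_bases hD' with h | h <;> omega
      obtain ⟨u, hu, v, hv, huv⟩ := (Set.one_lt_ncard).1 hcard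
      exact (blocks_joining U u v huv).unique ⟨hb', hu, hv⟩ ⟨hDh, hss hu, hss hv⟩
    · apply h1c
      rw [inl_mem_extendBlock]
      obtain ⟨A, rfl⟩ := exists_code_eq z ((bases_spec U D' hD').1 d hd)
      refine ⟨A, hd, ?_⟩
      apply code_injective (z := z)
      rw [code_mul, h1, code_one]

/-- Isomorphisms of closures map the block at infinity to the block at infinity. -/
theorem image_infinity {U U' : AffineName} {π π' : ParallelismName}
    (σ : SL2 F ⊕ parallelism F π ≃ SL2 F ⊕ parallelism F π')
    (hσ : ∀ b, σ '' b ∈ closureBlocks (blocks z hz.eq U') (parallelism F π') ↔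
      b ∈ closureBlocks (blocks z hz.eq U) (parallelism F π)) :
    σ '' blockAtInfinity (parallelism F π) = blockAtInfinity (parallelism F π') :=
  image_blockAtInfinity (hasTwins_blockAtInfinity U π) (not_hasTwins_extendBlock U' π') σ hσ

end Infinity

/-! ### A numerical invariant of pairs of points -/

/-- Evaluate all entries of the list before applying `k`. -/
def withList : List ℕ → (List ℕ → Bool) → Bool
  | [], k => k []
  | a :: l, k => withNat a fun a => withList l fun l => k (a :: l)

theorem withList_eq (l : List ℕ) (k : List ℕ → Bool) : withList l k = k l := by
  induction l generalizing k with
  | nil => rfl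
  | cons a l ih => rw [withList, withNat_eq, ih]

/-- The values of the invariant for `WU`, as digits in base `32`. -/
def invTableWU : ℕ :=
  20351871437512011732951541974040070194435969940428304754474608898859005321176750399459833043442191567598201010617562969265415577960379254311582075498488688230281584764569901444085399916651994174546067315491632353306362010713314265124819873276864873410009951587360421102527119544541242072346891550877864569263224795728738722524393515924164249875055516798470205680525309044212103865631135474135901768355264701482540466859443705385621208362482982629531602709986466188668151965776505273712102249361015418716503106051358484478750120973742067655589620964257627453883790884700391881456378192673032285908085518552642863507893886409739816421451334293452391078445294169059267851720119870574715445965958066384862763577411617273222163000627319450444997988051148961728084176794719232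

/-- The values of the invariant for `OU` and `PU`, as digits in base `32`. -/
def invTableOU : ℕ :=
  36022729623169321375304034943560890958696161084800409240412638563424535634620670725551757606190939687931524038070547775815036266064858562721690826508318995210309177011735623538051550760955331995468878376712070322689328208897576369424197696668893414575397532074248174428603307537124224095417663043732491429916234519782108406560894129507871537883096669983524424334677577758297590591623540728530804860197400006862161435523253822913743519825078815932199535844418826776766444637417414394319441617912591689170522369383824694096872129816877429434200368939811039379622905680733700103897286630371159268850819701303855678494744952532442224947515736332714152622201405389553776994015099318589321404268783498457222710469526413896873582705928736173127405157105350575142094214316332032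

/-- Either table. -/
def invTable : AffineName → ℕ
  | .WU => invTableWU
  | .OU => invTableOU
  | .PU => invTableOU

/-- The position of the element `x` in the tables. -/
def pos (x : ℕ) : ℕ :=
  bif Nat.beq (Nat.land x 7) 0 then Nat.add (Nat.land x 56) (Nat.mul 64 (Nat.shiftRight x 9))
  else Nat.land x 511

/-- The invariant of the element `x` according to the table `T`. -/
def inv (T x : ℕ) : ℕ := Nat.land (Nat.shiftRight T (Nat.mul 5 (pos x))) 31

/-- The number of elements of trace `0` in the translate `l y`. -/
def traceCount (y : ℕ) (l : List ℕ) : ℕ := l.countP fun x => Nat.beq (ctr x y) 0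

/-- The set of all `h` for which `D h` has three elements of trace `0`. -/
def traceMask (D : List ℕ) : ℕ := maskOf (elems.filter fun h => Nat.beq (traceCount h D) 3)

/-- Translates of $C$ contribute nothing to the invariant, so only the six sets in $\mathcal D$ need
masks. -/
theorem traceCount_cycL : ∀ y ∈ elems, traceCount y cycL ≠ 3 := by
  have h : (elems.all fun y => !Nat.beq (traceCount y cycL) 3) = true := by decide +kernel
  intro y hy h3
  have := List.all_eq_true.1 h y hy
  rw [h3] at this
  cases this

/-- The number of long blocks through `y` with three elements of trace `0`, computed from the
masks `ms`. -/
def arcCount (U : AffineName) (ms : List ℕ) (y : ℕ) : ℕ :=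
  (List.zipWith (fun D m => D.countP fun d => bit m (cmul (cinv d) y)) (arcL U) ms).sum

-- The table loses nothing: `pos` keeps $a,b,c$ if $a\ne0$, and $b,d$ if $a=0$, where the
-- determinant gives the remaining entry. `OU` and `PU` are each checked against the same table.
set_option maxHeartbeats 0 in
theorem arcCount_eq (U : AffineName) : ∀ y ∈ elems,
    arcCount U ((arcL U).map traceMask) y = inv (invTable U) y := by
  have h : (withList ((arcL U).map traceMask) fun ms => elems.all fun y =>
      Nat.beq (arcCount U ms y) (inv (invTable U) y)) = true := by cases U <;> decide +kernel
  rw [withList_eq] at h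
  exact fun y hy => Nat.eq_of_beq_eq_true (List.all_eq_true.1 h y hy)

/-- Some points of the unital; the automorphism group acts regularly on the orbit of the second one
under the stabilizer of the first one. -/
def frame : AffineName → List ℕ
  | .WU => [mk 1 0 0 1, mk 2 1 5 2, mk 0 3 6 6, mk 5 7 4 0, mk 2 0 6 5, mk 0 2 5 0]
  | _ => [mk 1 0 0 1, mk 1 0 3 1, mk 1 5 3 5, mk 1 1 6 7, mk 2 6 2 3, mk 0 1 1 4]

/-- The second point of the frame. -/
def framePoint : AffineName → ℕ
  | .WU => mk 2 1 5 2
  | _ => mk 1 0 3 1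

/-- The invariants of `x` with respect to the points in `l`. -/
def keyOf (T : ℕ) (l : List ℕ) (x : ℕ) : ℕ :=
  l.foldl (fun s a => Nat.add (Nat.mul 32 s) (inv T (cmul x (cinv a)))) 0

/-- The invariants with respect to the points in `l` determine the point `b`. -/
def determines (T : ℕ) (l : List ℕ) (b : ℕ) : Bool :=
  elems.all fun y => Nat.beq y b || l.any fun a =>
    !Nat.beq (inv T (cmul y (cinv a))) (inv T (cmul b (cinv a)))

/-- Each entry of the second list is determined by the preceding points. -/
def frameCheck (T : ℕ) : List ℕ → List ℕ → Bool
  | _, [] => true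
  | l, b :: bs => determines T l b && frameCheck T (b :: l) bs

/-- Once the first two frame points are fixed, each further one is the only point with its
invariants relative to the previous ones, so it is fixed as well. -/
theorem frameCheck_eq (U : AffineName) :
    frameCheck (invTable U) ((frame U).take 2) ((frame U).drop 2) = true := by
  cases U <;> decide +kernel

/-- A map that preserves the invariant and fixes the frame is therefore the identity. The keys stay
distinct modulo 26907, which keeps the bit mask of the check short. -/
theorem keyOf_inj (U : AffineName) : ∀ x ∈ elems, ∀ y ∈ elems,
    keyOf (invTable U) (frame U) x = keyOf (invTable U) (frame U) y → x = y := by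
  have h : nodupFrom 0 (elems.map fun x => Nat.mod (keyOf (invTable U) (frame U) x) 26907) =
    true := by cases U <;> decide +kernel
  intro x hx y hy hxy
  exact List.inj_on_of_nodup_map (nodupFrom_spec h).1 hx hy (by rw [hxy])

/-- Codes of matrices that normalize the unital. -/
def normalizer : AffineName → List ℕ
  | .WU => [mk 1 0 0 1, mk 0 1 1 0, mk 0 1 1 1, mk 1 0 1 1, mk 1 1 0 1, mk 1 1 1 0]
  | _ => cycL

/-- The possible images of the second frame point under maps fixing 1 are all reached by known
automorphisms: conjugations by $\mathrm{SL}(2,2)$ for `WU` and by $C$ otherwise, combined with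
powers of Frobenius. -/
theorem exists_normalizer (U : AffineName) : ∀ y ∈ elems,
    inv (invTable U) y = inv (invTable U) (framePoint U) →
      ∃ m ∈ normalizer U, ∃ k < 3, cconj m (cfrob^[k] (framePoint U)) = y := by
  have h : (elems.all fun y => !Nat.beq (inv (invTable U) y) (inv (invTable U) (framePoint U)) ||
      (normalizer U).any fun m => (List.range 3).any fun k =>
        Nat.beq (cconj m (cfrob^[k] (framePoint U))) y) = true := by cases U <;> decide +kernel
  intro y hy hv
  have := List.all_eq_true.1 h y hy
  rw [hv] at this
  simpa using this

theorem inv_framePoint_ne : ∀ y ∈ elems,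
    inv invTableOU y ≠ inv invTableWU (framePoint .WU) ∧
      inv invTableWU y ≠ inv invTableOU (framePoint .OU) := by
  have h : (elems.all fun y => !Nat.beq (inv invTableOU y) (inv invTableWU (framePoint .WU)) &&
    !Nat.beq (inv invTableWU y) (inv invTableOU (framePoint .OU))) = true := by decide +kernel
  intro y hy
  have := List.all_eq_true.1 h y hy
  simpa only [Bool.and_eq_true, Bool.not_eq_true', ← Bool.not_eq_true, Nat.beq_eq] using this

/-- The image of each base block under `c` is contained in a line of the same length. -/
def permutesLines (U : AffineName) (c : ℕ → ℕ) : Bool :=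
  (bases U).all fun D => (lines U).any fun l => Nat.beq l.length D.length &&
    D.all fun x => l.any (Nat.beq (c x))

theorem permutesLines_cfrob (U : AffineName) : permutesLines U cfrob = true := by
  cases U <;> decide +kernel

theorem permutesLines_cconj (U : AffineName) :
    ∀ m ∈ normalizer U, m ∈ elems ∧ permutesLines U (cconj m) = true := by
  have h : ((normalizer U).all fun m => isElem m && permutesLines U (cconj m)) = true := by
    cases U <;> decide +kernel
  intro m hm
  have := List.all_eq_true.1 h m hm
  rwa [Bool.and_eq_true, isElem_iff] at this

/-- The invariant cannot tell `OU` from `PU`; this shows at least that their block sets differ. -/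
theorem ouL4_notMem_lines : ∀ l ∈ lines .PU, ∃ x ∈ ouL4, x ∉ l := by decide +kernel

theorem comp_iso {P : Type*} {B₁ B₂ B₃ : Set (Set P)} {e f : Equiv.Perm P}
    (he : ∀ b, e '' b ∈ B₂ ↔ b ∈ B₁) (hf : ∀ b, f '' b ∈ B₃ ↔ b ∈ B₂) (b : Set P) :
    (f * e : Equiv.Perm P) '' b ∈ B₃ ↔ b ∈ B₁ := by
  rw [Equiv.Perm.coe_mul, Set.image_comp, hf, he]

/-! ### Isomorphisms of the affine unitals and of the closures -/

section Isomorphisms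

variable {F : Type*} [Field F] [CharP F 2] {z : F} [hz : IsRoot8 z]

theorem ctr_code_mul (A B : SL2 F) : ctr (code z (A * B)) 513 = ctr (code z A) (code z B) := by
  rw [← code_one (z := z), ctr_code, ctr_code, mul_one]

theorem mem_nbhd_one {U : AffineName} {x : SL2 F} :
    x ∈ nbhd 8 (blocks z hz.eq U) 1 ↔ ctr (code z x) 513 = 0 := by
  rw [← trace_eq_zero_iff _ (code_mem_elems x)]
  constructor
  · rintro ⟨s, hs, h8, h1, hx⟩
    obtain ⟨l, hl, rfl⟩ := one_mem_block_iff.1 ⟨hs, h1⟩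
    rw [ncard_lset_lines hl] at h8
    rcases length_lines hl with h | h
    · exact ⟨l, h.1, hx⟩
    · omega
  · rintro ⟨l, hl, hx⟩
    obtain ⟨hb, h1⟩ := one_mem_block_iff (z := z) |>.2 ⟨l, mem_lines_of_mem_sylL (U := U) hl, rfl⟩
    exact ⟨_, hb, ncard_sylL hl, h1, hx⟩

theorem ncard_inter_nbhd {U : AffineName} {l : List ℕ} (hl : l ∈ lines U) (y : SL2 F) :
    (rightTranslate (lset z l) y ∩ nbhd 8 (blocks z hz.eq U) 1).ncard =
      traceCount (code z y) l := by
  have h : rightTranslate (lset z l) y ∩ nbhd 8 (blocks z hz.eq U) 1 =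
      rightTranslate (lset z (l.filter fun x => Nat.beq (ctr x (code z y)) 0)) y := by
    ext x
    rw [Set.mem_inter_iff, mem_rightTranslate, mem_rightTranslate, mem_nbhd_one, mem_lset, mem_lset,
      List.mem_filter, Nat.beq_eq, ← ctr_code_mul, inv_mul_cancel_right]
  rw [h, ncard_rightTranslate, ncard_lset (fun x hx => (lines_spec U l hl).1 x (List.mem_filter.1 hx).1)
    ((lines_spec U l hl).2.2.filter _), traceCount, List.countP_eq_length_filter]

/-- The property counted by the invariant. -/
def isTraceThree (y : ℕ) (l : List ℕ) : Bool := Nat.beq l.length 9 && Nat.beq (traceCount y l) 3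

/-- The block $Dd^{-1}y$ through $y$ is the translate of $D$ by $d^{-1}y$, so one mask for each $D$
serves all blocks. -/
theorem traceCount_lineOf {U : AffineName} {D : List ℕ} (hD : D ∈ arcL U) (d y : SL2 F) :
    traceCount (code z y) (lineOf D (code z d)) = traceCount (code z (d⁻¹ * y)) D := by
  rw [traceCount, traceCount, lineOf, List.countP_map]
  refine List.countP_congr fun x hx => ?_
  obtain ⟨A, rfl⟩ := exists_code_eq z ((bases_spec U D (bases_of_mem_arcL hD)).1 x hx)
  simp only [Function.comp]
  rw [← code_inv, ← code_mul, ← ctr_code_mul, ← ctr_code_mul, mul_assoc]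

theorem countP_isTraceThree (U : AffineName) (y : SL2 F) :
    (lines U).countP (isTraceThree (code z y)) = inv (invTable U) (code z y) := by
  rw [← arcCount_eq U _ (code_mem_elems y), lines, List.countP_append, List.countP_cons]
  have h1 : sylL.countP (isTraceThree (code z y)) = 0 := by
    rw [List.countP_eq_zero]
    intro l hl
    rw [isTraceThree, sylL_length l hl]
    simp
  have h2 : isTraceThree (code z y) cycL = false := by
    rw [isTraceThree, Bool.and_eq_false_iff, ← Bool.not_eq_true, ← Bool.not_eq_true, Nat.beq_eq,
      Nat.beq_eq]
    exact Or.inr (traceCount_cycL _ (code_mem_elems y))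
  rw [h1, h2, List.countP_flatMap, arcCount, List.zipWith_map_right, List.zipWith_self]
  simp only [Bool.false_eq_true, if_false, zero_add]
  congr 1
  refine List.map_congr_left fun D hD => ?_
  simp only [Function.comp, List.countP_map]
  refine List.countP_congr fun d hd => ?_
  obtain ⟨d, rfl⟩ := exists_code_eq z ((bases_spec U D (bases_of_mem_arcL hD)).1 d hd)
  simp only [Function.comp, isTraceThree, Bool.and_eq_true, Nat.beq_eq]
  rw [traceCount_lineOf hD, lineOf, List.length_map, arcL_length U D hD, traceMask, bit_maskOf,
    List.mem_filter, Nat.beq_eq, ← code_inv, ← code_mul]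
  simp [code_mem_elems]

theorem pairInvariant_one (U : AffineName) (y : SL2 F) :
    pairInvariant 8 9 3 (blocks z hz.eq U) 1 y = inv (invTable U) (code z y) := by
  rw [← countP_isTraceThree]
  refine ncard_blocks_through U y
    (fun c => c.ncard = 9 ∧ (c ∩ nbhd 8 (blocks z hz.eq U) 1).ncard = 3) _ fun l hl => ?_
  rw [ncard_inter_nbhd hl, ncard_rightTranslate, ncard_lset_lines hl, isTraceThree,
    Bool.and_eq_true, Nat.beq_eq, Nat.beq_eq]

theorem pairInvariant_eq (U : AffineName) (x y : SL2 F) :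
    pairInvariant 8 9 3 (blocks z hz.eq U) x y = inv (invTable U) (code z (y * x⁻¹)) := by
  rw [← pairInvariant_one, ← pairInvariant_map (Equiv.mulRight x⁻¹) (mulRight_mem_autGroup U x⁻¹)]
  simp

theorem inv_code_map {U U' : AffineName} {e : SL2 F ≃ SL2 F}
    (he : ∀ b, e '' b ∈ blocks z hz.eq U' ↔ b ∈ blocks z hz.eq U) (x y : SL2 F) :
    inv (invTable U') (code z (e y * (e x)⁻¹)) = inv (invTable U) (code z (y * x⁻¹)) := by
  rw [← pairInvariant_eq, ← pairInvariant_eq, pairInvariant_map e he]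

theorem frame_mem (U : AffineName) : ∀ a ∈ frame U, a ∈ elems := by
  have h : (frame U).all isElem = true := by cases U <;> decide +kernel
  exact fun a ha => isElem_iff.1 (List.all_eq_true.1 h a ha)

theorem determines_spec {T : ℕ} {l : List ℕ} {b : ℕ} (h : determines T l b = true) {y : ℕ}
    (hy : y ∈ elems)
    (hl : ∀ a ∈ l, inv T (cmul y (cinv a)) = inv T (cmul b (cinv a))) : y = b := by
  have := List.all_eq_true.1 h y hy
  rw [Bool.or_eq_true, Nat.beq_eq, List.any_eq_true] at this
  rcases this with h | ⟨a, ha, h⟩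
  · exact h
  · rw [hl a ha] at h
    simp at h

/-- An isomorphism between unitals with the same invariants that fixes the first two points of the
frame is the identity. -/
theorem eq_of_fixes_frame {U U' : AffineName} (hT : invTable U = invTable U') {e : SL2 F ≃ SL2 F}
    (he : ∀ b, e '' b ∈ blocks z hz.eq U' ↔ b ∈ blocks z hz.eq U)
    (hfix : ∀ A : SL2 F, code z A ∈ (frame U).take 2 → e A = A) (A : SL2 F) : e A = A := by
  have hinv : ∀ x y : SL2 F, e x = x → inv (invTable U) (cmul (code z (e y)) (cinv (code z x))) =
      inv (invTable U) (cmul (code z y) (cinv (code z x))) := by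
    intro x y hx
    have := inv_code_map he x y
    rwa [hx, ← hT, code_mul, code_mul, code_inv] at this
  have hstep : ∀ bs l : List ℕ, frameCheck (invTable U) l bs = true → (∀ a ∈ l, a ∈ elems) →
      (∀ a ∈ bs, a ∈ elems) → (∀ A : SL2 F, code z A ∈ l → e A = A) →
      ∀ A : SL2 F, code z A ∈ bs → e A = A := by
    intro bs
    induction bs with
    | nil => intro l _ _ _ _ A hA; cases hA
    | cons b bs ih =>
      intro l hc hl hbs hfix
      rw [frameCheck, Bool.and_eq_true] at hc
      have hb : ∀ A : SL2 F, code z A = b → e A = A := by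
        rintro A rfl
        refine code_injective (z := z) (determines_spec hc.1 (code_mem_elems _) fun a ha => ?_)
        obtain ⟨x, rfl⟩ := exists_code_eq z (hl a ha)
        exact hinv x A (hfix x ha)
      have hfix' : ∀ A : SL2 F, code z A ∈ b :: l → e A = A := by
        intro A hA
        rcases List.mem_cons.1 hA with h | h
        · exact hb A h
        · exact hfix A h
      intro A hA
      rcases List.mem_cons.1 hA with h | h
      · exact hb A h
      · refine ih (b :: l) hc.2 ?_ (fun a ha => hbs a (List.mem_cons_of_mem _ ha)) hfix' A h
        intro a ha
        rcases List.mem_cons.1 ha with rfl | h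
        · exact hbs _ List.mem_cons_self
        · exact hl a h
  have hall : ∀ A : SL2 F, code z A ∈ frame U → e A = A := by
    intro A hA
    rw [← List.take_append_drop 2 (frame U), List.mem_append] at hA
    rcases hA with h | h
    · exact hfix A h
    · exact hstep _ _ (frameCheck_eq U) (fun a ha => frame_mem U a (List.mem_of_mem_take ha))
        (fun a ha => frame_mem U a (List.mem_of_mem_drop ha)) hfix A h
  -- With the whole frame fixed, $A$ and its image have the same key.
  apply code_injective (z := z)
  apply keyOf_inj U _ (code_mem_elems _) _ (code_mem_elems _)
  rw [keyOf, keyOf]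
  refine List.foldl_ext _ _ _ fun s a ha => ?_
  obtain ⟨x, rfl⟩ := exists_code_eq z (frame_mem U a ha)
  rw [hinv x A (hall x ha)]

/-- The Frobenius automorphism of `SL(2, 8)`. -/
noncomputable def frobAut (z : F) [IsRoot8 z] : MulAut (SL2 F) :=
  have := finite_SL2 z
  MulEquiv.ofBijective (Matrix.SpecialLinearGroup.map (frobenius F 2))
    (Finite.injective_iff_bijective.1 fun A B h => by
      ext i j
      have := congrArg (fun C : SL2 F => C i j) h
      exact frobenius_inj F 2 this)

theorem code_frobAut (A : SL2 F) : code z (frobAut z A) = cfrob (code z A) := code_frobenius A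

/-- A group automorphism carries right translates to right translates, so checking the base blocks
suffices; containment in a line of the same size is equality. -/
theorem toPerm_mem_autGroup {U : AffineName} {θ : MulAut (SL2 F)} {c : ℕ → ℕ}
    (hc : ∀ A, code z (θ A) = c (code z A)) (h : permutesLines U c = true) :
    MulAut.toPerm _ θ ∈ autGroup (blocks z hz.eq U) := by
  have := finite_SL2 z
  refine mem_autGroup_of_forall fun b hb => ?_
  obtain ⟨D, hD, g, rfl⟩ := mem_blocks_iff.1 hb
  have h1 := List.all_eq_true.1 h D hD
  obtain ⟨l, hl, h2⟩ := List.any_eq_true.1 h1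
  rw [Bool.and_eq_true, Nat.beq_eq, List.all_eq_true] at h2
  have himage : θ '' lset z D = lset z l := by
    refine Set.eq_of_subset_of_ncard_le ?_ ?_
    · rintro _ ⟨A, hA, rfl⟩
      rw [mem_lset, hc]
      simpa using h2.2 _ hA
    · rw [Set.ncard_image_of_injective _ θ.injective, ncard_lset_lines hl, ncard_lset_bases hD, h2.1]
  have hmap : MulAut.toPerm _ θ '' rightTranslate (lset z D) g =
      rightTranslate (lset z l) (θ g) := by
    rw [image_rightTranslate (σ := MulAut.toPerm _ θ) (θ := θ) (k := 1) (fun x => (mul_one _).symm),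
      mul_one, himage]
  rw [hmap, rightTranslate_mem_blocks]
  exact (one_mem_block_iff.2 ⟨l, hl, rfl⟩).1

theorem frobAut_mem (U : AffineName) :
    MulAut.toPerm _ (frobAut z) ∈ autGroup (blocks z hz.eq U) :=
  toPerm_mem_autGroup code_frobAut (permutesLines_cfrob U)

theorem conj_mem {U : AffineName} {m : SL2 F} (hm : code z m ∈ normalizer U) :
    MulAut.toPerm _ (MulAut.conj m⁻¹) ∈ autGroup (blocks z hz.eq U) := by
  refine toPerm_mem_autGroup (c := cconj (code z m)) (fun A => ?_) (permutesLines_cconj U _ hm).2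
  rw [MulAut.conj_apply, inv_inv, code_mul, code_mul, code_inv, cconj]

theorem code_frobAut_pow (k : ℕ) (A : SL2 F) :
    code z ((frobAut z ^ k) A) = cfrob^[k] (code z A) := by
  induction k with
  | zero => rfl
  | succ k ih =>
    rw [pow_succ', MulAut.mul_apply, code_frobAut, ih, Function.iterate_succ_apply']

theorem frame_take_two (U : AffineName) : (frame U).take 2 = [513, framePoint U] := by
  cases U <;> decide +kernel

theorem framePoint_mem (U : AffineName) : framePoint U ∈ elems := by
  rw [← isElem_iff]; cases U <;> decide +kernel

/-- Isomorphisms between unitals with the same invariants. -/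
theorem exists_mulAut {U U' : AffineName} (hT : invTable U = invTable U')
    (hp : framePoint U = framePoint U') {e : Equiv.Perm (SL2 F)}
    (he : ∀ b, e '' b ∈ blocks z hz.eq U' ↔ b ∈ blocks z hz.eq U) :
    e ∈ autGroup (blocks z hz.eq U') ∧ ∃ (θ : MulAut (SL2 F)) (k : SL2 F), ∀ x, e x = θ x * k := by
  -- Composing with a translation of the target makes 1 fixed.
  set f : Equiv.Perm (SL2 F) := Equiv.mulRight (e 1)⁻¹ * e with hf
  have hfiso := comp_iso he (mulRight_mem_autGroup U' (e 1)⁻¹)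
  have hf1 : f 1 = 1 := by simp [hf]
  obtain ⟨p, hpc⟩ := exists_code_eq z (framePoint_mem U')
  have hfp : inv (invTable U') (code z (f p)) = inv (invTable U') (framePoint U') := by
    have := inv_code_map hfiso 1 p
    rw [← hf, hf1, inv_one, mul_one, mul_one, hpc] at this
    rw [this, hT]
  obtain ⟨m, hm, k, -, hmk⟩ := exists_normalizer U' _ (code_mem_elems (f p)) hfp
  obtain ⟨m, rfl⟩ := exists_code_eq z (permutesLines_cconj U' m hm).1
  let θ : MulAut (SL2 F) := MulAut.conj m⁻¹ * frobAut z ^ k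
  have hθp : θ p = f p := by
    apply code_injective (z := z)
    rw [← hmk, MulAut.mul_apply, MulAut.conj_apply, inv_inv, code_mul, code_mul, code_inv,
      code_frobAut_pow, hpc, cconj]
  have hθ : MulAut.toPerm _ θ ∈ autGroup (blocks z hz.eq U') := by
    rw [map_mul, map_pow]
    exact mul_mem (conj_mem hm) (pow_mem (frobAut_mem U') k)
  -- $\theta$ agrees with `f` at the first two frame points, so $\theta^{-1}f$ is the identity. Both
  -- factors of `e` are now automorphisms of the target unital, even if the source is a different
  -- one.
  have hid := eq_of_fixes_frame hT (e := (MulAut.toPerm _ θ)⁻¹ * f)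
    (comp_iso hfiso (inv_mem hθ)) (by
      intro A hA
      rw [frame_take_two, hp] at hA
      rw [Equiv.Perm.mul_apply, Equiv.Perm.inv_eq_iff_eq]
      rcases List.mem_cons.1 hA with h | h
      · obtain rfl : A = 1 := code_injective (h.trans (code_one (z := z)).symm)
        rw [hf1]; exact (map_one θ).symm
      · obtain rfl : A = p := code_injective ((List.mem_singleton.1 h).trans hpc.symm)
        exact hθp.symm)
  have hfθ : ∀ x, f x = θ x := fun x => by
    have := hid x
    rwa [Equiv.Perm.mul_apply, Equiv.Perm.inv_eq_iff_eq] at this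
  have hex : ∀ x, e x = θ x * e 1 := fun x => by
    rw [← hfθ, hf]; simp
  refine ⟨?_, θ, e 1, hex⟩
  have : e = Equiv.mulRight (e 1) * MulAut.toPerm _ θ := Equiv.ext hex
  rw [this]
  exact mul_mem (mulRight_mem_autGroup U' _) hθ

theorem image_parallelism {U : AffineName} {σ : Equiv.Perm (SL2 F)}
    (hσ : σ ∈ autGroup (blocks z hz.eq U)) (π : ParallelismName) :
    ∀ c ∈ parallelism F π, Set.image σ '' c ∈ parallelism F π := by
  obtain ⟨-, θ, k, h⟩ := exists_mulAut rfl rfl hσ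
  exact image_class_mem h π

theorem blocks_OU_ne_blocks_PU : blocks z hz.eq .OU ≠ blocks z hz.eq .PU := by
  intro h
  have hm : ouL4 ∈ arcL .OU := by simp [arcL, conjL]
  have hb : lset z ouL4 ∈ blocks z hz.eq .OU :=
    mem_blocks_iff.2 ⟨_, bases_of_mem_arcL hm, 1, (rightTranslate_one _).symm⟩
  rw [h] at hb
  have hs := bases_spec .OU ouL4 (bases_of_mem_arcL hm)
  obtain ⟨l, hl, hl'⟩ := one_mem_block_iff.1
    ⟨hb, show (1 : SL2 F) ∈ lset z ouL4 by rw [mem_lset, code_one]; exact hs.2.1⟩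
  obtain ⟨x, hx, hxl⟩ := ouL4_notMem_lines l hl
  exact hxl (lset_injective hs.1 hx hl')

theorem not_iso_WU {U U' : AffineName} (h : framePoint U ≠ framePoint U') (e : SL2 F ≃ SL2 F) :
    ¬ ∀ b, e '' b ∈ blocks z hz.eq U' ↔ b ∈ blocks z hz.eq U := by
  intro he
  obtain ⟨p, hp⟩ := exists_code_eq z (framePoint_mem U)
  have h1 := inv_code_map he 1 p
  rw [inv_one, mul_one, hp] at h1
  have h2 := inv_framePoint_ne _ (code_mem_elems (z := z) (e p * (e 1)⁻¹))
  match U, U' with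
  | .WU, .WU | .OU, .OU | .PU, .PU => exact h rfl
  | .OU, .PU | .PU, .OU => exact h rfl
  | .WU, .OU | .WU, .PU => exact h2.1 h1
  | .OU, .WU | .PU, .WU => exact h2.2 h1

/-- Isomorphic affine unitals have the same name. -/
theorem eq_of_iso {U U' : AffineName} (e : SL2 F ≃ SL2 F)
    (he : ∀ b, e '' b ∈ blocks z hz.eq U' ↔ b ∈ blocks z hz.eq U) : U = U' := by
  by_cases hp : framePoint U = framePoint U'
  · have hT : invTable U = invTable U' := by
      match U, U' with
      | .WU, .WU | .OU, .OU | .PU, .PU => rfl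
      | .OU, .PU | .PU, .OU => rfl
      | .WU, .OU | .WU, .PU | .OU, .WU | .PU, .WU => exact absurd hp (by decide +kernel)
    -- As `e` is also an automorphism of the target, source and target have the same block set.
    have hE := (exists_mulAut hT hp he).1
    have hb : blocks z hz.eq U = blocks z hz.eq U' :=
      Set.ext fun b => (he b).symm.trans (hE b)
    match U, U' with
    | .WU, .WU | .OU, .OU | .PU, .PU => rfl
    | .OU, .PU => exact absurd hb blocks_OU_ne_blocks_PU
    | .PU, .OU => exact absurd hb.symm blocks_OU_ne_blocks_PU
    | .WU, .OU | .WU, .PU | .OU, .WU | .PU, .WU => exact absurd hp (by decide +kernel)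
  · exact absurd he (not_iso_WU hp e)

/-- A common class would consist of the left cosets and of the right cosets of one Sylow subgroup
$T$. Then $gT=(gTg^{-1})g$ forces $gTg^{-1}=T$ for all $g$, but there are nine Sylow 2-subgroups. -/
theorem flat_notMem_natural (z : F) [hz : IsRoot8 z] {c : Set (Set (SL2 F))}
    (hc : c ∈ parallelism F .flat) : c ∉ parallelism F .natural := by
  have := finite_SL2 z
  obtain ⟨T, rfl⟩ := hc
  rintro ⟨T', h⟩
  have hT : T' = T := by
    have h1 : (T' : Set (SL2 F)) ∈ {b | ∃ g, b = leftTranslate g (T' : Set (SL2 F))} :=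
      ⟨1, by simp [leftTranslate]⟩
    rw [← h] at h1
    obtain ⟨g, hg⟩ := h1
    exact eq_of_rightTranslate_eq ((rightTranslate_one _).trans hg)
  subst hT
  have hconj : ∀ g : SL2 F, g • T' = T' := by
    intro g
    have h1 : leftTranslate g (T' : Set (SL2 F)) ∈
        {b | ∃ g, b = leftTranslate g (T' : Set (SL2 F))} := ⟨g, rfl⟩
    rw [← h] at h1
    obtain ⟨g', hg'⟩ := h1
    rw [leftTranslate_eq_rightTranslate] at hg'
    exact eq_of_rightTranslate_eq hg'
  have hsub : Subsingleton (Sylow 2 (SL2 F)) := ⟨fun P Q => by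
    obtain ⟨a, rfl⟩ := MulAction.exists_smul_eq (SL2 F) T' P
    obtain ⟨b, rfl⟩ := MulAction.exists_smul_eq (SL2 F) T' Q
    rw [hconj, hconj]⟩
  have := card_sylow z
  rw [Nat.card_of_subsingleton T'] at this
  omega

/-- Isomorphic closures have the same names. -/
theorem eq_of_isIsomorphic {U U' : AffineName} {π π' : ParallelismName}
    (h : IsIsomorphic (closureBlocks (blocks z hz.eq U) (parallelism F π))
      (closureBlocks (blocks z hz.eq U') (parallelism F π'))) : (U, π) = (U', π') := by
  obtain ⟨σ, hσ⟩ := h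
  have hne : ∀ U, ∀ b ∈ blocks z hz.eq U, b.Nonempty := fun U b hb => by
    apply Set.nonempty_of_ncard_ne_zero
    rcases (isAffineUnital U).card_block b hb with h | h <;> omega
  obtain ⟨e, -, he, hcl⟩ := exists_restriction (hne U) (hne U') σ hσ (image_infinity σ hσ)
  obtain rfl := eq_of_iso e he
  -- the automorphism `e` maps classes of `π` to classes of `π` and of `π'`
  have hboth : ∃ c ∈ parallelism F π, c ∈ parallelism F π' := by
    have T := upperSylow z
    obtain ⟨c, hc⟩ : (parallelism F π).Nonempty := by cases π <;> exact ⟨_, T, rfl⟩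
    obtain ⟨c', -, hc'⟩ := hcl ⟨c, hc⟩
    -- The image lies in $\pi$ because affine automorphisms preserve both parallelisms, and in
    -- $\pi'$ because `e` comes from an isomorphism of closures.
    refine ⟨_, image_parallelism he π c hc, ?_⟩
    have : Set.image e '' c = c'.1 := by
      ext b
      obtain ⟨b, rfl⟩ := e.surjective.image_surjective b
      rw [e.injective.image_injective.mem_set_image]
      constructor
      · intro hb
        exact (hc' b ((isParallelism (z := z) U π).1.mem_blocks hc hb).1).1 hb
      · intro hb
        have h1 := ((isParallelism (z := z) U π').1.mem_blocks c'.2 hb).1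
        exact (hc' b ((he b).1 h1)).2 hb
    rw [this]
    exact c'.2
  obtain ⟨c, h1, h2⟩ := hboth
  cases π <;> cases π' <;> first
    | rfl
    | exact absurd h2 (flat_notMem_natural z h1)
    | exact absurd h1 (flat_notMem_natural z h2)

end Isomorphisms

end SL2Unital

/-! ### The six closures and their automorphism groups -/

theorem mainTheorem4 {F : Type*} [Field F] [CharP F 2] (hF : Nat.card F = 8)
    (z : F) (hz : z ^ 3 = z + 1) :
    -- the three affine unitals, the two parallelisms and the six closures exist as claimed
    (∀ U : SL2Unital.AffineName,
      SL2Unital.IsAffineSL2Unital 2 (SL2Unital.cyclicC z hz) (SL2Unital.arcuate z hz U) ∧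
      SL2Unital.IsAffineUnital 8 (SL2Unital.blocks z hz U) ∧
      ∀ π : SL2Unital.ParallelismName,
        SL2Unital.IsParallelism 8 (SL2Unital.blocks z hz U) (SL2Unital.parallelism F π) ∧
        SL2Unital.IsUnital 8
          (SL2Unital.closureBlocks (SL2Unital.blocks z hz U) (SL2Unital.parallelism F π))) ∧
    -- the six closures are pairwise non-isomorphic
    (∀ (U U' : SL2Unital.AffineName) (π π' : SL2Unital.ParallelismName),
      (U, π) ≠ (U', π') →
      ¬ SL2Unital.IsIsomorphic
          (SL2Unital.closureBlocks (SL2Unital.blocks z hz U) (SL2Unital.parallelism F π))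
          (SL2Unital.closureBlocks (SL2Unital.blocks z hz U') (SL2Unital.parallelism F π'))) ∧
    -- `Aut(U^π) = Aut(U^π)_{[∞]}`, and restriction to the affine points identifies this group
    -- with `Aut(U)`
    (∀ (U : SL2Unital.AffineName) (π : SL2Unital.ParallelismName),
      SL2Unital.autGroup
          (SL2Unital.closureBlocks (SL2Unital.blocks z hz U) (SL2Unital.parallelism F π)) =
        SL2Unital.autStabilizer
          (SL2Unital.closureBlocks (SL2Unital.blocks z hz U) (SL2Unital.parallelism F π))
          (SL2Unital.blockAtInfinity (SL2Unital.parallelism F π)) ∧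
      ∃ Φ : SL2Unital.autGroup
              (SL2Unital.closureBlocks (SL2Unital.blocks z hz U) (SL2Unital.parallelism F π)) ≃*
            SL2Unital.autGroup (SL2Unital.blocks z hz U),
        ∀ σ (x : SL2Unital.SL2 F), σ.1 (Sum.inl x) = Sum.inl ((Φ σ).1 x)) := by
  have : SL2Unital.IsRoot8 z := ⟨hF, hz⟩
  have := SL2Unital.finite_SL2 z
  refine ⟨fun U => ⟨SL2Unital.isAffineSL2Unital U, SL2Unital.isAffineUnital U, fun π =>
    ⟨(SL2Unital.isParallelism U π).1, SL2Unital.isUnital U π⟩⟩,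
    fun U U' π π' hne h => hne (SL2Unital.eq_of_isIsomorphic h), fun U π => ⟨?_, ?_⟩⟩
  · ext σ
    exact ⟨fun hσ => ⟨hσ, SL2Unital.image_infinity (z := z) (U := U) (U' := U) σ hσ⟩,
      fun hσ => hσ.1⟩
  · exact SL2Unital.exists_mulEquiv_autGroup (SL2Unital.isAffineUnital U)
      (SL2Unital.isParallelism (z := z) U π).1
      (fun σ hσ => SL2Unital.image_infinity (z := z) (U := U) (U' := U) σ hσ)
      (fun σ hσ => SL2Unital.image_parallelism hσ π)
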